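/- **Theorem 1.** Consider arms $b_1,\dots,b_K$ ($K\ge 1$) and a preference function $\phi$ with values in $[-1/2,1/2]$: in a duel between $b_i$ and $b_j$ exactly one of the two wins, and $b_i$ wins with probability $P(b_i\succ b_j)=\phi(b_i,b_j)+1/2$, so that $\phi(b_j,b_i)=-\phi(b_i,b_j)$. Write $b_i\succ b_j$ for $\phi(b_i,b_j)>0$, and assume that this is a total order, with the arms labelled so that $b_i\succ b_j\iff i<j$. Assume *Approximate Linearity*: there is a constant $\gamma>0$ such that $\phi(b_i,b_k)-\phi(b_j,b_k)\ge\gamma\,\phi(b_i,b_j)$ for all $b_i\succ b_j\succ b_k$. Let $m\ge 2$, let $\eta>0$, and for each round $t=1,2,\dots$ fix a nonempty set $G_t$ of unordered pairs of distinct slots in $\{1,\dots,m\}$ (for instance all pairs, or a single pair). The algorithm IndSelfSparring starts with $S_i=F_i=0$ for every arm $i$. In round $t$ it selects, for each slot $j=1,\dots,m$ independently, the arm $i_j(t)=\arg\max_i\theta_i$, where $\theta_1,\dots,\theta_K$ are fresh independent samples $\theta_i\sim\mathrm{Beta}(S_i+1,F_i+1)$. Then for each pair $\{j,k\}\in G_t$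 the arms in slots $j$ and $k$ are dueled; given the selected arms, the duels are independent of each other and of the past. For each such duel the statistic $S$ of the winning slot's arm and the statistic $F$ of the losing slot's arm are each increased by $\eta$. Then IndSelfSparring converges to the optimal arm $b_1$: for every slot $j$, $$\lim_{t\to\infty}\mathbb P\bigl(i_j(t)=1\bigr)=1 .$$ -/

import Mathlib

open MeasureTheory ProbabilityTheory Filter Topology
open scoped NNReal

/-- A stochastic dueling bandits problem with `K` arms. The preference function `φ` has
values in `[-1/2, 1/2]`; arm `i` beats arm `j` in a duel with probability `φ i j + 1/2`, and
exactly one of the two wins, so `φ` is antisymmetric. The relation `i ≻ j`, that is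
`0 < φ i j`, is a total order, and the arms are labelled from the best one (arm `0`) to the
worst one. -/
structure DuelingBandit (K : ℕ) where
  φ : Fin K → Fin K → ℝ
  antisymm : ∀ i j, φ i j = -φ j i
  abs_phi_le : ∀ i j, |φ i j| ≤ 1 / 2
  pos_iff : ∀ i j, 0 < φ i j ↔ i < j

namespace DuelingBandit

variable {K : ℕ}

/-- The probability `P(b_i ≻ b_j) = φ(b_i, b_j) + 1/2` that arm `i` wins a duel against
arm `j`. -/
noncomputable def winProb (B : DuelingBandit K) (i j : Fin K) : unitInterval :=
  ⟨B.φ i j + 1 / 2, by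
    have h := _root_.abs_le.1 (B.abs_phi_le i j)
    constructor <;> linarith [h.1, h.2]⟩

/-- Approximate linearity: for some constant `γ > 0`, all triplets `b_i ≻ b_j ≻ b_k` satisfy
`φ(b_i, b_k) - φ(b_j, b_k) ≥ γ φ(b_i, b_j)`. -/
def ApproxLinear (B : DuelingBandit K) : Prop :=
  ∃ γ : ℝ, 0 < γ ∧ ∀ i j k, 0 < B.φ i j → 0 < B.φ j k →
    γ * B.φ i j ≤ B.φ i k - B.φ j k

end DuelingBandit

namespace IndSelfSparring

/-! ### One round -/

/-- The learning statistics: the weighted numbers `S i` of wins and `F i` of losses of each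
arm `i`. -/
structure Stats (K : ℕ) where
  S : Fin K → ℝ≥0
  F : Fin K → ℝ≥0

/-- The initial statistics, `S i = F i = 0`. -/
def Stats.init (K : ℕ) : Stats K := ⟨fun _ => 0, fun _ => 0⟩

/-- The record of one round with `m` slots: the arm selected for each slot, and the outcomes of
potential duels between slots. For slots `j < k`, entry `(j, k)` of the second component is
`true` if the arm in slot `j` wins a duel against the arm in slot `k`; the entries with `j ≥ k`
are never used. Which duels take place and are observed is determined by the feedback graph. -/
abbrev Round (K m : ℕ) : Type := (Fin m → Fin K) × (Fin m → Fin m → Bool)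

section argmax

variable {K : ℕ} [NeZero K]

theorem argmax_nonempty (θ : Fin K → ℝ) :
    (Finset.univ.filter fun i => ∀ k, θ k ≤ θ i).Nonempty := by
  obtain ⟨i, hi⟩ := Finite.exists_max θ
  exact ⟨i, by simpa using hi⟩

/-- The index of the maximal coordinate of `θ` (the least such index; ties have probability zero
below). -/
noncomputable def argmax (θ : Fin K → ℝ) : Fin K :=
  (Finset.univ.filter fun i => ∀ k, θ k ≤ θ i).min' (argmax_nonempty θ)

theorem argmax_eq_iff (θ : Fin K → ℝ) (i : Fin K) :
    argmax θ = i ↔ (∀ k, θ k ≤ θ i) ∧ ∀ l, (∀ k, θ k ≤ θ l) → i ≤ l := by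
  constructor
  · rintro rfl
    refine ⟨?_, fun l hl => Finset.min'_le _ _ (by simpa using hl)⟩
    have h := Finset.min'_mem _ (argmax_nonempty θ)
    rw [Finset.mem_filter] at h
    exact h.2
  · rintro ⟨h1, h2⟩
    refine le_antisymm (Finset.min'_le _ _ (by simpa using h1)) ?_
    refine Finset.le_min' _ _ _ fun l hl => h2 l ?_
    simpa using hl

theorem measurable_argmax : Measurable (argmax : (Fin K → ℝ) → Fin K) := by
  refine measurable_to_countable' fun i => ?_
  have h : (argmax : (Fin K → ℝ) → Fin K) ⁻¹' {i} =
      {θ | (∀ k, θ k ≤ θ i) ∧ ∀ l, (∀ k, θ k ≤ θ l) → i ≤ l} := by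
    ext θ
    exact argmax_eq_iff θ i
  rw [h]
  measurability

end argmax

section round

variable {K m : ℕ}

/-- The law of the posterior sample `θ`: independent coordinates
`θ i ∼ Beta (S i + 1, F i + 1)`. -/
noncomputable def sampleLaw (D : Stats K) : Measure (Fin K → ℝ) :=
  Measure.pi fun i => betaMeasure (D.S i + 1) (D.F i + 1)

/-- The law of the arm selected for one slot: the arm with maximal `θ i`. -/
noncomputable def selectLaw [NeZero K] (D : Stats K) : Measure (Fin K) :=
  (sampleLaw D).map argmax

/-- The law of the outcomes of all potential duels when the arms `a` are played: independent
Bernoulli variables, the arm `a j` beating the arm `a k` with probability `P(a j ≻ a k)`. -/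
noncomputable def duelLaw (B : DuelingBandit K) (a : Fin m → Fin K) :
    Measure (Fin m → Fin m → Bool) :=
  Measure.pi fun j => Measure.pi fun k => bernoulliMeasure true false (B.winProb (a j) (a k))

/-- The law of a round given the current statistics: a fresh posterior sample is drawn
independently for each of the `m` slots, and the selected arms are then dueled. -/
noncomputable def roundLaw [NeZero K] (B : DuelingBandit K) (m : ℕ) (D : Stats K) :
    Measure (Round K m) :=
  (Measure.pi fun _ : Fin m => selectLaw D) ⊗ₘ Kernel.ofFunOfCountable (duelLaw B)

open scoped Classical in
/-- The feedback matrix `R` of a round. The edges of the graph `G` are the pairs of slots that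
are compared in the round. Entry `r_{jk}` says whether the arm in slot `j` beats the arm in slot
`k`, and is `none` (that is, `∅`) when this pair of slots is not compared. A single duel
determines both `r_{jk}` and `r_{kj} = 1 - r_{jk}`. -/
noncomputable def feedback (G : SimpleGraph (Fin m)) (x : Round K m) (j k : Fin m) :
    Option Bool :=
  if G.Adj j k then some (if j < k then x.2 j k else !x.2 k j) else none

/-- The update of the statistics after a round with learning rate `η`: every valid entry `r_{jk}`
adds `η r_{jk}` to `S` and `η (1 - r_{jk})` to `F` of the arm in slot `j`. -/
noncomputable def update (η : ℝ≥0) (G : SimpleGraph (Fin m)) (x : Round K m) (D : Stats K) :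
    Stats K where
  S i := D.S i + ∑ j, ∑ k, if x.1 j = i ∧ feedback G x j k = some true then η else 0
  F i := D.F i + ∑ j, ∑ k, if x.1 j = i ∧ feedback G x j k = some false then η else 0

/-- The statistics after the first `n` rounds of the sequence of rounds `x`, where `G t` is the
feedback graph of round `t`. -/
noncomputable def stats (η : ℝ≥0) (G : ℕ → SimpleGraph (Fin m)) (x : ℕ → Round K m) :
    ℕ → Stats K
  | 0 => Stats.init K
  | n + 1 => update η (G n) (x n) (stats η G x n)

/-! ### The law of an infinite run -/

/-- The transition kernel from the history of rounds `0, …, n` to round `n + 1`. (The history is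
extended arbitrarily to an infinite sequence; only its first `n + 1` terms are read.) -/
noncomputable def step [NeZero K] (B : DuelingBandit K) (η : ℝ≥0) (G : ℕ → SimpleGraph (Fin m))
    (n : ℕ) : Kernel ((_ : Finset.Iic n) → Round K m) (Round K m) :=
  Kernel.ofFunOfCountable fun h =>
    roundLaw B m (stats η G
      (fun t => if ht : t ≤ n then h ⟨t, Finset.mem_Iic.2 ht⟩ else default) (n + 1))

instance (D : Stats K) (i : Fin K) :
    IsProbabilityMeasure (betaMeasure (D.S i + 1) (D.F i + 1)) :=
  isProbabilityMeasureBeta (by positivity) (by positivity)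

instance (D : Stats K) : IsProbabilityMeasure (sampleLaw D) := by
  unfold sampleLaw; infer_instance

instance [NeZero K] (D : Stats K) : IsProbabilityMeasure (selectLaw D) :=
  Measure.isProbabilityMeasure_map measurable_argmax.aemeasurable

instance (B : DuelingBandit K) (a : Fin m → Fin K) : IsProbabilityMeasure (duelLaw B a) := by
  unfold duelLaw; infer_instance

instance (B : DuelingBandit K) : IsMarkovKernel
    (Kernel.ofFunOfCountable (duelLaw B : (Fin m → Fin K) → Measure (Fin m → Fin m → Bool))) :=
  ⟨fun a => inferInstanceAs (IsProbabilityMeasure (duelLaw B a))⟩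

instance [NeZero K] (B : DuelingBandit K) (D : Stats K) :
    IsProbabilityMeasure (roundLaw B m D) := by
  unfold roundLaw; infer_instance

instance [NeZero K] (B : DuelingBandit K) (η : ℝ≥0) (G : ℕ → SimpleGraph (Fin m)) (n : ℕ) :
    IsMarkovKernel (step B η G n) :=
  ⟨fun h => inferInstanceAs (IsProbabilityMeasure (roundLaw B m (stats η G
      (fun t => if ht : t ≤ n then h ⟨t, Finset.mem_Iic.2 ht⟩ else default) (n + 1))))⟩

/-- The law of an infinite run of the algorithm, as a measure on sequences of rounds. -/
noncomputable def runLaw [NeZero K] (B : DuelingBandit K) (η : ℝ≥0)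
    (G : ℕ → SimpleGraph (Fin m)) : Measure (ℕ → Round K m) :=
  Kernel.trajMeasure (X := fun _ => Round K m) (roundLaw B m (Stats.init K)) (step B η G)

instance [NeZero K] (B : DuelingBandit K) (η : ℝ≥0) (G : ℕ → SimpleGraph (Fin m)) :
    IsProbabilityMeasure (runLaw B η G) := by
  unfold runLaw; infer_instance

end round

end IndSelfSparring

/-!
The total order alone drives the convergence: arm `0` beats every other arm with a margin, and an
arm `k` loses in expectation against every better arm.

Write `net k = S k - F k` and `plays k = S k + F k`. A duel of an arm against itself leaves `net`
unchanged, and the posterior of arm `k` is concentrated around `1 / 2 + net k / (2 * plays k)` at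
scale `(plays k) ^ (-1 / 2)`. All probabilistic input comes from one criterion
(`ae_bddAbove_partialSum`): a sum of bounded increments whose conditional mean is at most a
negative multiple of their conditional absolute mean is almost surely bounded above, because a
small multiple of it has an exponential that is a supermartingale. It is applied to predictable
linear combinations of duel results (`ae_bddAbove_duels`), and the outcomes are collected in
`TypicalRun`; the rest is an argument about a single run.

The surplus `net 0` is bounded below, since the best arm gains in every duel against another arm.
So the sample of arm `0` exceeds `1 / 2` with a probability bounded away from `0`, however often
the arm has been played (`le_posterior_Ioi_half`).

The other arms are then eliminated one after the other, from the worst one upwards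
(`TypicalRun.eliminated_of_worse`), in the sense that `net k ≤ C - κ * plays k`. Suppose that all
arms worse than `k` are eliminated; they are then selected with vanishing probability
(`Eliminated.tendsto_selProb`). As long as `net k ≤ √(plays k)`, the sample of `k` is at most
`1 / 2` with a probability bounded away from `0` (`le_posterior_Iic_half`), so that the better
arms keep a fixed share of the selection, and `net k` has a negative drift proportional to the
plays of `k`. If `net k > √(plays k)`, then `k` may be selected almost all the time, and it can
still gain from duels against worse arms. But the tails of Beta distributions are `o(1 / (a + b))`
(`exists_betaMeasure_real_Ici_le`), so a worse arm `j` is selected with a probability of order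
`(plays k) ^ (-1 / 2)` at least only while `plays j` is smaller than a small multiple of
`√(plays k)` (`exists_selProb_le_div_sqrt`). Summing up, `net k` is at most `√(plays k + 1) / 2`
up to a constant, and so the second case stops occurring (`TypicalRun.eventually_net_le`), unless
`k` is played finitely often, where there is nothing to prove. Once all arms but arm `0` are
eliminated, the selection probability of arm `0` tends to `1` along the run, and dominated
convergence concludes.
-/

/-! ### Histories and a drift criterion -/

namespace IndSelfSparring

variable {K m : ℕ}

/-- The statistics after `n` rounds depend on these rounds only. -/
theorem stats_congr (η : ℝ≥0) (G : ℕ → SimpleGraph (Fin m)) {x y : ℕ → Round K m} :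
    ∀ n, (∀ t < n, x t = y t) → stats η G x n = stats η G y n
  | 0, _ => rfl
  | n + 1, h => by
    rw [stats, stats, stats_congr η G n fun t ht => h t (ht.trans n.lt_succ_self),
      h n n.lt_succ_self]

/-- The partial sums of a function of the current statistics and the current round. -/
noncomputable def partialSum (η : ℝ≥0) (G : ℕ → SimpleGraph (Fin m))
    (f : ℕ → Stats K → Round K m → ℝ) (x : ℕ → Round K m) (n : ℕ) : ℝ :=
  ∑ t ∈ Finset.range n, f t (stats η G x t) (x t)

theorem partialSum_congr (η : ℝ≥0) (G : ℕ → SimpleGraph (Fin m))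
    (f : ℕ → Stats K → Round K m → ℝ) {x y : ℕ → Round K m} (n : ℕ)
    (h : ∀ t < n, x t = y t) : partialSum η G f x n = partialSum η G f y n := by
  refine Finset.sum_congr rfl fun t ht => ?_
  have ht := Finset.mem_range.1 ht
  rw [h t ht, stats_congr η G t fun s hs => h s (hs.trans ht)]

variable [NeZero K]

theorem step_frestrictLe (B : DuelingBandit K) (η : ℝ≥0) (G : ℕ → SimpleGraph (Fin m)) (n : ℕ)
    (x : ℕ → Round K m) :
    step B η G n (Preorder.frestrictLe n x) = roundLaw B m (stats η G x (n + 1)) := by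
  change roundLaw B m _ = _
  congr 1
  refine stats_congr η G _ fun t ht => ?_
  rw [dif_pos (Nat.lt_succ_iff.1 ht)]
  rfl

/-- Conditionally on the first `n + 1` rounds, the next round has the law `roundLaw` for the
current statistics. -/
theorem integral_history_next (B : DuelingBandit K) (η : ℝ≥0) (G : ℕ → SimpleGraph (Fin m))
    (n : ℕ) (F : ((_ : Finset.Iic n) → Round K m) → Round K m → ℝ) :
    ∫ x, F (Preorder.frestrictLe n x) (x (n + 1)) ∂runLaw B η G =
      ∫ x, ∫ y, F (Preorder.frestrictLe n x) y ∂roundLaw B m (stats η G x (n + 1))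
        ∂runLaw B η G := by
  have key := Kernel.map_frestrictLe_trajMeasure_compProd_eq_map_trajMeasure
    (X := fun _ => Round K m) (μ₀ := roundLaw B m (Stats.init K)) (κ := step B η G) (a := n)
  change (runLaw B η G).map _ ⊗ₘ _ = (runLaw B η G).map _ at key
  have h1 : ∫ x, F (Preorder.frestrictLe n x) (x (n + 1)) ∂runLaw B η G =
      ∫ z, F z.1 z.2 ∂((runLaw B η G).map
        (fun x => (Preorder.frestrictLe (π := fun _ => Round K m) n x, x (n + 1)))) := by
    rw [integral_map (by fun_prop) (by
      exact (measurable_of_countable _).aestronglyMeasurable)]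
  rw [h1, ← key, Measure.integral_compProd (Integrable.of_finite), integral_map (by fun_prop)
    (measurable_of_countable _).aestronglyMeasurable]
  simp_rw [step_frestrictLe]

/-- As the history space is countable, every function of the rounds `0, …, n` is measurable with
respect to the canonical filtration. -/
theorem measurable_of_history {β : Type*} [MeasurableSpace β] (n : ℕ) (f : (ℕ → Round K m) → β)
    (hf : ∀ x y, (∀ t ≤ n, x t = y t) → f x = f y) :
    Measurable[Filtration.piLE (X := fun _ => Round K m) n] f := by
  have h : f = (fun h : (_ : Finset.Iic n) → Round K m => f
      (fun t => if ht : t ≤ n then h ⟨t, Finset.mem_Iic.2 ht⟩ else default)) ∘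
        Preorder.frestrictLe n := by
    funext x
    refine hf _ _ fun t ht => ?_
    rw [dif_pos ht]; rfl
  rw [h, Filtration.piLE_eq_comap_frestrictLe]
  exact (measurable_of_countable _).comp (comap_measurable _)

theorem measurable_of_history' {β : Type*} [MeasurableSpace β] (n : ℕ) (f : (ℕ → Round K m) → β)
    (hf : ∀ x y, (∀ t ≤ n, x t = y t) → f x = f y) : Measurable f :=
  (measurable_of_history n f hf).mono (Filtration.le _ n) le_rfl

/-- The one step estimate behind the drift criterion, from `exp z ≤ 1 + z + z ^ 2` for
`|z| ≤ 1`. -/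
theorem integral_exp_le_one {Ω : Type*} [MeasurableSpace Ω] [Finite Ω]
    [MeasurableSingletonClass Ω] (P : Measure Ω)
    [IsProbabilityMeasure P] (g : Ω → ℝ) {b κ : ℝ} (hb : 1 ≤ b) (hκ : 0 ≤ κ) (hκ1 : κ ≤ 1)
    (hg : ∀ y, |g y| ≤ b) (hd : ∫ y, g y ∂P ≤ -κ * ∫ y, |g y| ∂P) :
    ∫ y, Real.exp (κ / b * g y) ∂P ≤ 1 := by
  have hb0 : 0 < b := by linarith
  have h1 : ∀ y, Real.exp (κ / b * g y) ≤ 1 + κ / b * g y + κ / b * κ * |g y| := by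
    intro y
    have hle : |κ / b * g y| ≤ 1 := by
      rw [abs_mul, abs_of_nonneg (by positivity)]
      calc κ / b * |g y| ≤ κ / b * b := by gcongr; exact hg y
        _ = κ := by field_simp
        _ ≤ 1 := hκ1
    have h2 := (abs_le.1 (Real.abs_exp_sub_one_sub_id_le hle)).2
    have h3 : (κ / b * g y) ^ 2 ≤ κ / b * κ * |g y| := by
      rw [← sq_abs, abs_mul, abs_of_nonneg (by positivity : 0 ≤ κ / b)]
      have : κ / b * |g y| ≤ κ := by
        calc κ / b * |g y| ≤ κ / b * b := by gcongr; exact hg y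
          _ = κ := by field_simp
      calc (κ / b * |g y|) ^ 2 = (κ / b * |g y|) * (κ / b * |g y|) := by ring
        _ ≤ κ * (κ / b * |g y|) := by gcongr
        _ = _ := by ring
    linarith
  calc ∫ y, Real.exp (κ / b * g y) ∂P
      ≤ ∫ y, (1 + κ / b * g y + κ / b * κ * |g y|) ∂P :=
        integral_mono .of_finite .of_finite h1
    _ = 1 + κ / b * (∫ y, g y ∂P + κ * ∫ y, |g y| ∂P) := by
        rw [integral_add .of_finite .of_finite, integral_add .of_finite .of_finite,
          integral_const_mul, integral_const_mul]
        simp; ring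
    _ ≤ 1 := by
        have : κ / b * (∫ y, g y ∂P + κ * ∫ y, |g y| ∂P) ≤ 0 :=
          mul_nonpos_of_nonneg_of_nonpos (by positivity) (by linarith)
        linarith

/-- **Drift criterion.** If the increments are bounded and their conditional mean is at most a
negative multiple of their conditional absolute mean, then almost surely the partial sums are
bounded above: a small multiple of them has an exponential that is a supermartingale. -/
theorem ae_bddAbove_partialSum (B : DuelingBandit K) (η : ℝ≥0) (G : ℕ → SimpleGraph (Fin m))
    (f : ℕ → Stats K → Round K m → ℝ) {b κ : ℝ} (hκ : 0 < κ)
    (hf : ∀ n D y, |f n D y| ≤ b)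
    (hd : ∀ n D, ∫ y, f n D y ∂roundLaw B m D ≤ -κ * ∫ y, |f n D y| ∂roundLaw B m D) :
    ∀ᵐ x ∂runLaw B η G, ∃ C : ℝ, ∀ n, partialSum η G f x n ≤ C := by
  wlog hκ1 : κ ≤ 1 generalizing κ
  · refine this (κ := 1) one_pos (fun n D => (hd n D).trans ?_) le_rfl
    have : 0 ≤ ∫ y, |f n D y| ∂roundLaw B m D := integral_nonneg fun _ => abs_nonneg _
    nlinarith
  wlog hb : 1 ≤ b generalizing b
  · exact this (b := 1) (fun n D y => (hf n D y).trans (not_le.1 hb).le) le_rfl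
  set c := κ / b with hc
  have hb0 : 0 < b := by linarith
  have hc0 : 0 < c := by positivity
  -- The canonical filtration at time `n` contains round `n`, hence the shift by one.
  set M : ℕ → (ℕ → Round K m) → ℝ := fun n x => Real.exp (c * partialSum η G f x (n + 1)) with hM
  have hMle : ∀ n x, ‖M n x‖ ≤ Real.exp (c * ((n + 1) * b)) := by
    intro n x
    rw [Real.norm_eq_abs, abs_of_pos (Real.exp_pos _)]
    refine Real.exp_le_exp.2 (mul_le_mul_of_nonneg_left ?_ hc0.le)
    calc partialSum η G f x (n + 1) ≤ ∑ t ∈ Finset.range (n + 1), b :=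
          Finset.sum_le_sum fun t _ => (le_abs_self _).trans (hf _ _ _)
      _ = _ := by simp
  have hMc : ∀ n x y, (∀ t ≤ n, x t = y t) → M n x = M n y := by
    intro n x y h
    simp only [hM]
    rw [partialSum_congr η G f (n + 1) fun t ht => h t (Nat.lt_succ_iff.1 ht)]
  have hint : ∀ n, Integrable (M n) (runLaw B η G) := fun n =>
    Integrable.of_bound (measurable_of_history' n _ (hMc n)).aestronglyMeasurable _
      (Eventually.of_forall (hMle n))
  have hsuper : Supermartingale M (Filtration.piLE (X := fun _ => Round K m)) (runLaw B η G) := by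
    refine supermartingale_of_setIntegral_succ_le
      (fun n => (measurable_of_history n _ (hMc n)).stronglyMeasurable) hint fun n s hs => ?_
    have hs' : MeasurableSet s := Filtration.le _ n s hs
    rw [← integral_indicator hs', ← integral_indicator hs']
    rw [Filtration.piLE_eq_comap_frestrictLe] at hs
    obtain ⟨u, -, rfl⟩ := hs
    -- Extending a history arbitrarily makes the integrand a function of the history.
    set ext : ((_ : Finset.Iic n) → Round K m) → ℕ → Round K m := fun h t =>
      if ht : t ≤ n then h ⟨t, Finset.mem_Iic.2 ht⟩ else default with hext
    have hex : ∀ x t, t ≤ n → ext (Preorder.frestrictLe n x) t = x t := by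
      intro x t ht
      simp only [hext]
      rw [dif_pos ht]; rfl
    classical
    set F : ((_ : Finset.Iic n) → Round K m) → Round K m → ℝ := fun h y =>
      u.indicator (fun h => M n (ext h) *
        Real.exp (c * f (n + 1) (stats η G (ext h) (n + 1)) y)) h with hF
    have hst : ∀ x, stats η G (ext (Preorder.frestrictLe n x)) (n + 1) = stats η G x (n + 1) :=
      fun x => stats_congr η G _ fun t ht => hex x t (Nat.lt_succ_iff.1 ht)
    have hMe : ∀ x, M n (ext (Preorder.frestrictLe n x)) = M n x := fun x => hMc n _ _ (hex x)
    have h1 : ∀ x, (Preorder.frestrictLe n ⁻¹' u).indicator (M (n + 1)) x =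
        F (Preorder.frestrictLe n x) (x (n + 1)) := by
      intro x
      simp only [hF, Set.indicator, Set.mem_preimage]
      split_ifs
      · rw [hMe, hst]
        simp only [hM]
        rw [← Real.exp_add, partialSum, Finset.sum_range_succ, ← partialSum, mul_add]
      · rfl
    simp_rw [h1]
    rw [integral_history_next]
    refine integral_mono_of_nonneg (Eventually.of_forall fun x => integral_nonneg fun y => ?_)
      ((hint n).indicator hs') (Eventually.of_forall fun x => ?_)
    · simp only [hF]
      exact Set.indicator_nonneg (fun _ _ => by positivity) _
    · simp only [hF, Set.indicator, Set.mem_preimage]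
      split_ifs
      · rw [integral_const_mul, hMe, hst]
        have := integral_exp_le_one (roundLaw B m (stats η G x (n + 1)))
          (f (n + 1) (stats η G x (n + 1))) hb hκ.le hκ1 (hf _ _) (hd _ _)
        exact mul_le_of_le_one_right (Real.exp_pos _).le this
      · simp
  have hsub := hsuper.neg
  have hbdd : ∀ n, eLpNorm ((-M) n) 1 (runLaw B η G) ≤
      ((∫ x, M 0 x ∂runLaw B η G).toNNReal : ENNReal) := by
    intro n
    rw [Pi.neg_apply, eLpNorm_neg, eLpNorm_one_eq_lintegral_enorm,
      ← ofReal_integral_norm_eq_lintegral_enorm (hint n)]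
    change _ ≤ ENNReal.ofReal _
    refine ENNReal.ofReal_le_ofReal ?_
    have h := hsuper.setIntegral_le (Nat.zero_le n) MeasurableSet.univ
    rw [setIntegral_univ, setIntegral_univ] at h
    refine le_trans (le_of_eq ?_) h
    exact integral_congr_ae (Eventually.of_forall fun x => abs_of_pos (Real.exp_pos _))
  filter_upwards [hsub.exists_ae_tendsto_of_bdd hbdd] with x ⟨l, hl⟩
  have hl' : Tendsto (fun n => M n x) atTop (𝓝 (-l)) := by simpa using hl.neg
  obtain ⟨A, hA⟩ := hl'.bddAbove_range
  refine ⟨max 0 (A / c), fun n => ?_⟩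
  cases n with
  | zero => simp [partialSum]
  | succ n =>
    refine le_max_of_le_right ?_
    rw [le_div_iff₀ hc0]
    have h1 : M n x ≤ A := hA ⟨n, rfl⟩
    have h2 := Real.add_one_le_exp (c * partialSum η G f x (n + 1))
    simp only [hM] at h1
    linarith

end IndSelfSparring

/-! ### The duels of one round -/

namespace IndSelfSparring

variable {K m : ℕ}

/-- The surplus `S i - F i` of wins over losses of arm `i`. -/
noncomputable def Stats.net (D : Stats K) (i : Fin K) : ℝ := D.S i - D.F i

/-- The weighted number `S i + F i` of duels played by arm `i`, where a duel of `i` against itself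
counts twice. -/
noncomputable def Stats.plays (D : Stats K) (i : Fin K) : ℝ := D.S i + D.F i

theorem Stats.plays_nonneg (D : Stats K) (i : Fin K) : 0 ≤ D.plays i := by
  unfold Stats.plays; positivity

theorem Stats.abs_net_le (D : Stats K) (i : Fin K) : |D.net i| ≤ D.plays i := by
  unfold Stats.plays Stats.net
  have h1 := (D.S i).coe_nonneg
  have h2 := (D.F i).coe_nonneg
  rw [abs_le]; constructor <;> linarith

/-- Whether the arm in slot `a` beats the arm in slot `b`. -/
def slotWins (x : Round K m) (a b : Fin m) : Bool := if a < b then x.2 a b else !x.2 b a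

theorem slotWins_swap (x : Round K m) {a b : Fin m} (h : a ≠ b) :
    slotWins x b a = !slotWins x a b := by
  unfold slotWins
  rcases lt_or_gt_of_ne h with h | h
  · simp [h, h.not_gt]
  · simp [h, h.not_gt]

open scoped Classical in
/-- The number of ordered pairs of compared slots whose first slot holds arm `k` and whose second
slot holds arm `i`. -/
noncomputable def duelCount (G : SimpleGraph (Fin m)) (x : Round K m) (k i : Fin K) : ℝ :=
  ∑ a, ∑ b, if G.Adj a b then (if x.1 a = k ∧ x.1 b = i then 1 else 0) else 0

open scoped Classical in
/-- The number of wins minus the number of losses of arm `k` in the duels against arm `i`. -/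
noncomputable def duelGain (G : SimpleGraph (Fin m)) (x : Round K m) (k i : Fin K) : ℝ :=
  ∑ a, ∑ b, if G.Adj a b then
    (if x.1 a = k ∧ x.1 b = i then (if slotWins x a b then 1 else -1) else 0) else 0

open scoped Classical in
/-- The number of ordered pairs of compared slots, twice the number of edges of `G`. -/
noncomputable def dartCount (G : SimpleGraph (Fin m)) : ℝ :=
  ∑ a, ∑ b, if G.Adj a b then 1 else 0

theorem duelCount_nonneg (G : SimpleGraph (Fin m)) (x : Round K m) (k i : Fin K) :
    0 ≤ duelCount G x k i :=
  Finset.sum_nonneg fun a _ => Finset.sum_nonneg fun b _ => by split_ifs <;> norm_num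

theorem abs_duelGain_le (G : SimpleGraph (Fin m)) (x : Round K m) (k i : Fin K) :
    |duelGain G x k i| ≤ duelCount G x k i := by
  refine (Finset.abs_sum_le_sum_abs _ _).trans (Finset.sum_le_sum fun a _ =>
    (Finset.abs_sum_le_sum_abs _ _).trans (Finset.sum_le_sum fun b _ => ?_))
  split_ifs <;> simp

theorem duelCount_comm (G : SimpleGraph (Fin m)) (x : Round K m) (k i : Fin K) :
    duelCount G x k i = duelCount G x i k := by
  unfold duelCount
  rw [Finset.sum_comm]
  refine Finset.sum_congr rfl fun a _ => Finset.sum_congr rfl fun b _ => ?_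
  rw [G.adj_comm b a]
  simp only [and_comm]

/-- Duels of an arm against itself cancel: each is counted once as a win and once as a loss. -/
theorem duelGain_self (G : SimpleGraph (Fin m)) (x : Round K m) (k : Fin K) :
    duelGain G x k k = 0 := by
  have h : duelGain G x k k = -duelGain G x k k := by
    conv_lhs => rw [duelGain, Finset.sum_comm]
    rw [duelGain, ← Finset.sum_neg_distrib]
    refine Finset.sum_congr rfl fun a _ => ?_
    rw [← Finset.sum_neg_distrib]
    refine Finset.sum_congr rfl fun b _ => ?_
    by_cases hab : G.Adj a b
    · rw [if_pos hab, if_pos hab.symm, slotWins_swap x hab.ne]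
      simp only [and_comm (a := x.1 b = k)]
      split_ifs <;> simp_all
    · rw [if_neg hab, if_neg fun h => hab h.symm, neg_zero]
  linarith

theorem dartCount_le (G : SimpleGraph (Fin m)) : dartCount G ≤ m * m := by
  calc dartCount G ≤ ∑ _a : Fin m, ∑ _b : Fin m, (1 : ℝ) :=
        Finset.sum_le_sum fun a _ => Finset.sum_le_sum fun b _ => by split_ifs <;> norm_num
    _ = m * m := by simp

theorem one_le_dartCount (G : SimpleGraph (Fin m)) (hG : G ≠ ⊥) : 1 ≤ dartCount G := by
  classical
  obtain ⟨a, b, hab⟩ := SimpleGraph.ne_bot_iff_exists_adj.1 hG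
  have h0 : ∀ a b : Fin m, (0 : ℝ) ≤ if G.Adj a b then 1 else 0 := fun a b => by
    split_ifs <;> norm_num
  calc (1 : ℝ) = if G.Adj a b then 1 else 0 := by rw [if_pos hab]
    _ ≤ ∑ b, if G.Adj a b then 1 else 0 :=
        Finset.single_le_sum (f := fun b => if G.Adj a b then (1 : ℝ) else 0)
          (fun b _ => h0 a b) (Finset.mem_univ b)
    _ ≤ dartCount G := by
        unfold dartCount
        convert Finset.single_le_sum
          (f := fun a => ∑ b, if G.Adj a b then (1 : ℝ) else 0)
          (fun a _ => Finset.sum_nonneg fun b _ => h0 a b) (Finset.mem_univ a)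

theorem sum_duelCount_le (G : SimpleGraph (Fin m)) (x : Round K m) (k : Fin K) :
    ∑ i, duelCount G x k i ≤ dartCount G := by
  unfold duelCount dartCount
  rw [Finset.sum_comm]
  refine Finset.sum_le_sum fun a _ => ?_
  rw [Finset.sum_comm]
  refine Finset.sum_le_sum fun b _ => ?_
  by_cases hab : G.Adj a b
  · simp only [if_pos hab]
    by_cases hk : x.1 a = k <;> simp [hk]
  · simp [hab]

theorem plays_update (η : ℝ≥0) (G : SimpleGraph (Fin m)) (x : Round K m) (D : Stats K)
    (k : Fin K) :
    (update η G x D).plays k = D.plays k + η * ∑ i, duelCount G x k i := by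
  simp only [Stats.plays, update, NNReal.coe_add, NNReal.coe_sum]
  have h : (∑ a, ∑ b, (((if x.1 a = k ∧ feedback G x a b = some true then η else 0 : ℝ≥0)) : ℝ)) +
      (∑ a, ∑ b, (((if x.1 a = k ∧ feedback G x a b = some false then η else 0 : ℝ≥0)) : ℝ)) =
      η * ∑ i, duelCount G x k i := by
    unfold duelCount
    rw [Finset.sum_comm (s := (Finset.univ : Finset (Fin K))), ← Finset.sum_add_distrib,
      Finset.mul_sum]
    refine Finset.sum_congr rfl fun a _ => ?_
    rw [Finset.sum_comm (s := (Finset.univ : Finset (Fin K))), ← Finset.sum_add_distrib,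
      Finset.mul_sum]
    refine Finset.sum_congr rfl fun b _ => ?_
    unfold feedback
    by_cases hab : G.Adj a b
    · by_cases hk : x.1 a = k
      · simp only [hab, hk, if_true, true_and]
        cases h : (if a < b then x.2 a b else !x.2 b a) <;> simp
      · simp [hk]
    · simp [hab]
  rw [← h]; ring

theorem net_update (η : ℝ≥0) (G : SimpleGraph (Fin m)) (x : Round K m) (D : Stats K)
    (k : Fin K) :
    (update η G x D).net k = D.net k + η * ∑ i, duelGain G x k i := by
  simp only [Stats.net, update, NNReal.coe_add, NNReal.coe_sum]
  have h : (∑ a, ∑ b, (((if x.1 a = k ∧ feedback G x a b = some true then η else 0 : ℝ≥0)) : ℝ)) -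
      (∑ a, ∑ b, (((if x.1 a = k ∧ feedback G x a b = some false then η else 0 : ℝ≥0)) : ℝ)) =
      η * ∑ i, duelGain G x k i := by
    unfold duelGain
    rw [Finset.sum_comm (s := (Finset.univ : Finset (Fin K))), ← Finset.sum_sub_distrib,
      Finset.mul_sum]
    refine Finset.sum_congr rfl fun a _ => ?_
    rw [Finset.sum_comm (s := (Finset.univ : Finset (Fin K))), ← Finset.sum_sub_distrib,
      Finset.mul_sum]
    refine Finset.sum_congr rfl fun b _ => ?_
    unfold feedback slotWins
    by_cases hab : G.Adj a b
    · by_cases hk : x.1 a = k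
      · simp only [hab, hk, if_true, true_and]
        cases h : (if a < b then x.2 a b else !x.2 b a) <;> simp
      · simp [hk]
    · simp [hab]
  rw [← h]; ring

/-! ### Expectations over one round -/

variable [NeZero K]

/-- The probability that a given slot is filled with arm `i`. -/
noncomputable def selProb (D : Stats K) (i : Fin K) : ℝ := (selectLaw D).real {i}

theorem selProb_nonneg (D : Stats K) (i : Fin K) : 0 ≤ selProb D i := measureReal_nonneg

theorem selProb_le_one (D : Stats K) (i : Fin K) : selProb D i ≤ 1 := measureReal_le_one

theorem sum_selProb (D : Stats K) : ∑ i, selProb D i = 1 := by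
  simp only [selProb]
  rw [sum_measureReal_singleton]
  simp

theorem pi_selectLaw_two (D : Stats K) {a b : Fin m} (h : a ≠ b) (k i : Fin K) :
    (Measure.pi fun _ : Fin m => selectLaw D).real {s | s a = k ∧ s b = i} =
      selProb D k * selProb D i := by
  have hs : {s : Fin m → Fin K | s a = k ∧ s b = i} =
      Set.univ.pi fun j => if j = a then {k} else if j = b then {i} else Set.univ := by
    ext s
    simp only [Set.mem_ofPred_eq, Set.mem_pi, Set.mem_univ, true_implies]
    constructor
    · rintro ⟨h1, h2⟩ j
      split_ifs with h3 h4
      · subst h3; exact h1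
      · subst h4; exact h2
      · trivial
    · intro hj
      refine ⟨by simpa using hj a, by simpa [h.symm] using hj b⟩
  rw [hs, measureReal_def, Measure.pi_pi, ENNReal.toReal_prod,
    ← Finset.mul_prod_erase _ _ (Finset.mem_univ a),
    ← Finset.mul_prod_erase _ _ (Finset.mem_erase.2 ⟨h.symm, Finset.mem_univ b⟩)]
  rw [Finset.prod_eq_one (s := (Finset.univ.erase a).erase b)]
  · simp [h.symm, selProb, measureReal_def]
  · intro j hj
    simp only [Finset.mem_erase, Finset.mem_univ, and_true] at hj
    simp [hj.1, hj.2]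

omit [NeZero K] in
theorem integral_duelLaw_slot (B : DuelingBandit K) (s : Fin m → Fin K) (a b : Fin m)
    (h : Bool → ℝ) : ∫ y, h (y a b) ∂duelLaw B s =
      (1 / 2 + B.φ (s a) (s b)) * h true + (1 / 2 - B.φ (s a) (s b)) * h false := by
  have h1 := measurePreserving_eval (fun j => Measure.pi fun k =>
    bernoulliMeasure true false (B.winProb (s j) (s k))) a
  have h2 := measurePreserving_eval (fun k =>
    bernoulliMeasure true false (B.winProb (s a) (s k))) b
  have h3 := (h2.comp h1).map_eq
  have h4 : ∫ y, h (y a b) ∂duelLaw B s =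
      ∫ z, h z ∂bernoulliMeasure true false (B.winProb (s a) (s b)) := by
    rw [← h3, integral_map (h2.comp h1).measurable.aemeasurable
      (measurable_of_countable _).aestronglyMeasurable]
    rfl
  rw [h4, integral_bernoulliMeasure]
  simp [DuelingBandit.winProb]
  ring

theorem integral_roundLaw (B : DuelingBandit K) (D : Stats K) (f : Round K m → ℝ) :
    ∫ x, f x ∂roundLaw B m D =
      ∫ s, ∫ y, f (s, y) ∂duelLaw B s ∂(Measure.pi fun _ : Fin m => selectLaw D) := by
  rw [roundLaw, Measure.integral_compProd .of_finite]
  rfl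

theorem integral_pair (D : Stats K) {a b : Fin m} (h : a ≠ b) (k i : Fin K) (c : ℝ) :
    ∫ s, (if s a = k ∧ s b = i then c else 0) ∂(Measure.pi fun _ : Fin m => selectLaw D) =
      c * (selProb D k * selProb D i) := by
  rw [← pi_selectLaw_two D h]
  have : (fun s : Fin m → Fin K => if s a = k ∧ s b = i then c else 0) =
      Set.indicator {s | s a = k ∧ s b = i} (fun _ => c) := by
    funext s; simp [Set.indicator]
  rw [this, integral_indicator_const _ (Set.toFinite _).measurableSet]
  simp [mul_comm]

theorem integral_duelCount (B : DuelingBandit K) (D : Stats K) (G : SimpleGraph (Fin m))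
    (k i : Fin K) : ∫ x, duelCount G x k i ∂roundLaw B m D =
      dartCount G * (selProb D k * selProb D i) := by
  unfold duelCount dartCount
  rw [integral_finsetSum _ fun _ _ => .of_finite, Finset.sum_mul]
  refine Finset.sum_congr rfl fun a _ => ?_
  rw [integral_finsetSum _ fun _ _ => .of_finite, Finset.sum_mul]
  refine Finset.sum_congr rfl fun b _ => ?_
  by_cases hab : G.Adj a b
  · simp only [if_pos hab]
    rw [integral_roundLaw, ← integral_pair D hab.ne]
    refine integral_congr_ae (Eventually.of_forall fun s => ?_)
    by_cases hs : s a = k ∧ s b = i <;> simp [hs]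
  · simp [hab]

theorem integral_duelGain (B : DuelingBandit K) (D : Stats K) (G : SimpleGraph (Fin m))
    (k i : Fin K) : ∫ x, duelGain G x k i ∂roundLaw B m D =
      dartCount G * (2 * B.φ k i * (selProb D k * selProb D i)) := by
  unfold duelGain dartCount
  rw [integral_finsetSum _ fun _ _ => .of_finite, Finset.sum_mul]
  refine Finset.sum_congr rfl fun a _ => ?_
  rw [integral_finsetSum _ fun _ _ => .of_finite, Finset.sum_mul]
  refine Finset.sum_congr rfl fun b _ => ?_
  by_cases hab : G.Adj a b
  · simp only [if_pos hab]
    rw [integral_roundLaw, one_mul, ← integral_pair D hab.ne]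
    refine integral_congr_ae (Eventually.of_forall fun s => ?_)
    by_cases hs : s a = k ∧ s b = i
    · simp only [hs, and_self, if_true]
      rw [← hs.1, ← hs.2]
      rcases lt_or_gt_of_ne hab.ne with h | h
      · simp only [slotWins, h, if_true]
        rw [integral_duelLaw_slot B s a b (fun z => if z = true then 1 else -1)]
        simp; ring
      · simp only [slotWins, h.not_gt, if_false]
        rw [integral_duelLaw_slot B s b a (fun z => if (!z) = true then 1 else -1),
          B.antisymm (s a) (s b)]
        simp; ring
    · simp [hs]
  · simp [hab]

/-- The drift criterion for a predictable linear combination, with coefficients `α`, `β`, of the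
results and numbers of duels of arm `k`, compensated by a multiple `γ` of the conditional
expectation of the number of duels. -/
theorem ae_bddAbove_duels (B : DuelingBandit K) (η : ℝ≥0) (G : ℕ → SimpleGraph (Fin m))
    (k : Fin K) (α β : Stats K → Fin K → ℝ) (γ : Stats K → ℝ) {κ : ℝ} (hκ : 0 < κ)
    (hα : ∀ D i, |α D i| ≤ 1) (hβ : ∀ D i, |β D i| ≤ 1) (hγ : ∀ D, |γ D| ≤ 1)
    (hd : ∀ D, ∑ i, selProb D i * (2 * α D i * B.φ k i + β D i) + γ D ≤
      -κ * (∑ i, selProb D i * (|α D i| + |β D i|) + |γ D|)) :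
    ∀ᵐ x ∂runLaw B η G, ∃ C : ℝ, ∀ n, ∑ t ∈ Finset.range n,
      (∑ i, (α (stats η G x t) i * duelGain (G t) (x t) k i +
        β (stats η G x t) i * duelCount (G t) (x t) k i) +
        γ (stats η G x t) * (dartCount (G t) * selProb (stats η G x t) k)) ≤ C := by
  have hdart : ∀ n, 0 ≤ dartCount (G n) := fun n =>
    Finset.sum_nonneg fun a _ => Finset.sum_nonneg fun b _ => by split_ifs <;> norm_num
  have habs : ∀ n D (y : Round K m), |∑ i, (α D i * duelGain (G n) y k i +
        β D i * duelCount (G n) y k i) + γ D * (dartCount (G n) * selProb D k)| ≤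
      ∑ i, (|α D i| + |β D i|) * duelCount (G n) y k i +
        |γ D| * (dartCount (G n) * selProb D k) := by
    intro n D y
    refine (abs_add_le _ _).trans (add_le_add ((Finset.abs_sum_le_sum_abs _ _).trans
      (Finset.sum_le_sum fun i _ => (abs_add_le _ _).trans ?_)) (le_of_eq ?_))
    · rw [abs_mul, abs_mul, add_mul, abs_of_nonneg (duelCount_nonneg _ _ _ _)]
      gcongr
      exact abs_duelGain_le _ _ _ _
    · rw [abs_mul, abs_of_nonneg (mul_nonneg (hdart n) (selProb_nonneg D k))]
  refine ae_bddAbove_partialSum B η G (fun n D y => ∑ i, (α D i * duelGain (G n) y k i +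
        β D i * duelCount (G n) y k i) + γ D * (dartCount (G n) * selProb D k))
    (b := 3 * (m * m)) hκ (fun n D y => (habs n D y).trans ?_) fun n D => ?_
  · have h1 : ∑ i, (|α D i| + |β D i|) * duelCount (G n) y k i ≤ 2 * (m * m) := by
      calc ∑ i, (|α D i| + |β D i|) * duelCount (G n) y k i
          ≤ ∑ i, 2 * duelCount (G n) y k i := Finset.sum_le_sum fun i _ =>
            mul_le_mul_of_nonneg_right (by linarith [hα D i, hβ D i]) (duelCount_nonneg _ _ _ _)
        _ ≤ 2 * (m * m) := by
            rw [← Finset.mul_sum]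
            have := (sum_duelCount_le (G n) y k).trans (dartCount_le (G n))
            linarith
    have h2 : |γ D| * (dartCount (G n) * selProb D k) ≤ 1 * (m * m * 1) :=
      mul_le_mul (hγ D) (mul_le_mul (dartCount_le _) (selProb_le_one D k) (selProb_nonneg D k)
        (by positivity)) (mul_nonneg (hdart n) (selProb_nonneg D k)) zero_le_one
    linarith
  · have hq : 0 ≤ dartCount (G n) * selProb D k := mul_nonneg (hdart n) (selProb_nonneg D k)
    have h1 : ∫ y, (∑ i, (α D i * duelGain (G n) y k i + β D i * duelCount (G n) y k i) +
        γ D * (dartCount (G n) * selProb D k)) ∂roundLaw B m D =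
        dartCount (G n) * selProb D k *
          (∑ i, selProb D i * (2 * α D i * B.φ k i + β D i) + γ D) := by
      rw [integral_add .of_finite .of_finite, integral_finsetSum _ fun _ _ => .of_finite,
        mul_add, Finset.mul_sum]
      congr 1
      · refine Finset.sum_congr rfl fun i _ => ?_
        rw [integral_add .of_finite .of_finite, integral_const_mul, integral_const_mul,
          integral_duelGain, integral_duelCount]
        ring
      · simp [mul_comm]
    have h2 : ∫ y, |∑ i, (α D i * duelGain (G n) y k i + β D i * duelCount (G n) y k i) +
        γ D * (dartCount (G n) * selProb D k)| ∂roundLaw B m D ≤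
        dartCount (G n) * selProb D k *
          (∑ i, selProb D i * (|α D i| + |β D i|) + |γ D|) := by
      refine (integral_mono .of_finite .of_finite (habs n D)).trans (le_of_eq ?_)
      rw [integral_add .of_finite .of_finite, integral_finsetSum _ fun _ _ => .of_finite,
        mul_add, Finset.mul_sum]
      congr 1
      · refine Finset.sum_congr rfl fun i _ => ?_
        rw [integral_const_mul, integral_duelCount]
        ring
      · simp [mul_comm]
    have h3 := mul_le_mul_of_nonneg_left (hd D) hq
    rw [h1]
    nlinarith

end IndSelfSparring

/-! ### Beta distributions -/

namespace IndSelfSparring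

theorem betaMeasure_apply {a b : ℝ} {s : Set ℝ} (hs : MeasurableSet s) :
    betaMeasure a b s = ∫⁻ x in s, betaPDF a b x := withDensity_apply _ hs

theorem measurable_betaPDF (a b : ℝ) : Measurable (betaPDF a b) :=
  (measurable_betaPDFReal a b).ennreal_ofReal

theorem betaPDF_one_sub (a b x : ℝ) : betaPDF a b x = betaPDF b a (1 - x) := by
  have h : (0 < 1 - x ∧ 1 - x < 1) ↔ (0 < x ∧ x < 1) := by
    constructor <;> rintro ⟨h1, h2⟩ <;> constructor <;> linarith
  rw [betaPDF_eq, betaPDF_eq]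
  congr 1
  simp only [h, sub_sub_cancel, beta, mul_comm (Real.Gamma b), add_comm b a]
  split_ifs
  · ring
  · rfl

theorem measurePreserving_one_sub : MeasurePreserving (fun x : ℝ => 1 - x) volume volume :=
  Measure.measurePreserving_sub_left volume 1

theorem betaMeasure_preimage_one_sub (a b : ℝ) {s : Set ℝ} (hs : MeasurableSet s) :
    betaMeasure a b ((fun x => 1 - x) ⁻¹' s) = betaMeasure b a s := by
  rw [betaMeasure_apply (measurePreserving_one_sub.measurable hs), betaMeasure_apply hs,
    ← measurePreserving_one_sub.setLIntegral_comp_preimage hs (measurable_betaPDF b a)]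
  simp_rw [← betaPDF_one_sub]

/-- Comparison of the masses of two sets related by a volume preserving map, from a comparison of
the densities. -/
theorem betaMeasure_real_preimage_le {a b : ℝ} (ha : 0 < a) (hb : 0 < b) {g : ℝ → ℝ}
    (hg : MeasurePreserving g volume volume)
    {s : Set ℝ} (hs : MeasurableSet s) {C : ℝ} (hC : 0 ≤ C)
    (h : ∀ x, g x ∈ s → betaPDFReal a b x ≤ C * betaPDFReal a b (g x)) :
    (betaMeasure a b).real (g ⁻¹' s) ≤ C * (betaMeasure a b).real s := by
  have := isProbabilityMeasureBeta ha hb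
  rw [measureReal_def, measureReal_def, ← ENNReal.toReal_ofReal hC, ← ENNReal.toReal_mul]
  refine ENNReal.toReal_mono (ENNReal.mul_ne_top ENNReal.ofReal_ne_top (measure_ne_top _ _)) ?_
  rw [betaMeasure_apply (hg.measurable hs), betaMeasure_apply hs,
    ← lintegral_const_mul _ (measurable_betaPDF a b),
    ← hg.setLIntegral_comp_preimage hs ((measurable_betaPDF a b).const_mul _)]
  refine setLIntegral_mono' (hg.measurable hs) fun x hx => ?_
  rw [betaPDF, betaPDF, ← ENNReal.ofReal_mul hC]
  exact ENNReal.ofReal_le_ofReal (h x hx)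

theorem betaPDFReal_nonneg {a b : ℝ} (ha : 0 < a) (hb : 0 < b) (x : ℝ) :
    0 ≤ betaPDFReal a b x := by
  by_cases h : 0 < x ∧ x < 1
  · exact (betaPDFReal_pos h.1 h.2 ha hb).le
  · rw [betaPDFReal, if_neg h]

theorem beta_add_one_left {a b : ℝ} (ha : 0 < a) (hb : 0 < b) :
    beta (a + 1) b = a / (a + b) * beta a b := by
  have h := (Real.Gamma_pos_of_pos (add_pos ha hb)).ne'
  have hab := (add_pos ha hb).ne'
  rw [beta, beta, show a + 1 + b = a + b + 1 by ring, Real.Gamma_add_one ha.ne',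
    Real.Gamma_add_one hab]
  field_simp

theorem beta_comm (a b : ℝ) : beta a b = beta b a := by
  rw [beta, beta, mul_comm, add_comm]

theorem mul_betaPDFReal {a b : ℝ} (ha : 0 < a) (hb : 0 < b) (x : ℝ) :
    x * betaPDFReal a b x = a / (a + b) * betaPDFReal (a + 1) b x := by
  rw [betaPDFReal, betaPDFReal]
  split_ifs with h
  · have h1 : x ^ (a + 1 - 1) = x ^ (a - 1) * x := by
      rw [← Real.rpow_add_one h.1.ne']; congr 1; ring
    have h2 := (beta_pos ha hb).ne'
    have h3 := (add_pos ha hb).ne'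
    rw [h1, beta_add_one_left ha hb]
    field_simp
  · simp

theorem one_sub_mul_betaPDFReal {a b : ℝ} (ha : 0 < a) (hb : 0 < b) (x : ℝ) :
    (1 - x) * betaPDFReal a b x = b / (a + b) * betaPDFReal a (b + 1) x := by
  rw [betaPDFReal, betaPDFReal]
  split_ifs with h
  · have h1 : (1 - x) ^ (b + 1 - 1) = (1 - x) ^ (b - 1) * (1 - x) := by
      rw [← Real.rpow_add_one (by linarith [h.2])]; congr 1; ring
    have h2 := (beta_pos hb ha).ne'
    have h3 := (add_pos ha hb).ne'
    have h4 : b + a ≠ 0 := by rwa [add_comm]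
    rw [h1, beta_comm a (b + 1), beta_add_one_left hb ha, beta_comm a b, add_comm b a]
    field_simp
  · simp

/-- Markov's inequality in one step: the density for `a + 1` is a multiple of `x` times the
density for `a`. -/
theorem betaMeasure_real_Ici_le_succ {a b u : ℝ} (ha : 0 < a) (hb : 0 < b) (hu : 0 < u) :
    (betaMeasure a b).real (Set.Ici u) ≤
      a / (a + b) / u * (betaMeasure (a + 1) b).real (Set.Ici u) := by
  have := isProbabilityMeasureBeta (by positivity : 0 < a + 1) hb
  have hC : 0 ≤ a / (a + b) / u := by positivity
  rw [measureReal_def, measureReal_def, ← ENNReal.toReal_ofReal hC, ← ENNReal.toReal_mul]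
  refine ENNReal.toReal_mono (ENNReal.mul_ne_top ENNReal.ofReal_ne_top (measure_ne_top _ _)) ?_
  rw [betaMeasure_apply measurableSet_Ici, betaMeasure_apply measurableSet_Ici,
    ← lintegral_const_mul _ (measurable_betaPDF _ b)]
  refine setLIntegral_mono' measurableSet_Ici fun x hx => ?_
  rw [betaPDF, betaPDF, ← ENNReal.ofReal_mul hC]
  refine ENNReal.ofReal_le_ofReal ?_
  rw [div_mul_eq_mul_div, ← mul_betaPDFReal ha hb, le_div_iff₀ hu, mul_comm]
  exact mul_le_mul_of_nonneg_right hx (betaPDFReal_nonneg ha hb x)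

/-- Geometric bound for the upper tail of a Beta distribution: Markov's inequality for the `r`-th
moment, which is the product of the factors `(a + i) / (a + b + i)`. -/
theorem betaMeasure_real_Ici_le_pow {u v : ℝ} (hu : 0 < u) (r : ℕ) :
    ∀ {a b : ℝ}, 0 < a → 0 < b → a + r ≤ v * (a + b) →
      (betaMeasure a b).real (Set.Ici u) ≤ (v / u) ^ r := by
  induction r with
  | zero =>
    intro a b ha hb _
    have := isProbabilityMeasureBeta ha hb
    simp
  | succ r ih =>
    intro a b ha hb h
    push_cast at h
    have hr : (0 : ℝ) ≤ r := Nat.cast_nonneg r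
    have hv : 0 < v := by
      by_contra hv
      have : v * (a + b) ≤ 0 := mul_nonpos_of_nonpos_of_nonneg (not_lt.1 hv) (by positivity)
      linarith
    have h1 := ih (a := a + 1) (b := b) (by positivity) hb (by nlinarith)
    have h2 : a / (a + b) ≤ v := by
      rw [div_le_iff₀ (by positivity)]; linarith
    calc (betaMeasure a b).real (Set.Ici u)
        ≤ a / (a + b) / u * (betaMeasure (a + 1) b).real (Set.Ici u) :=
          betaMeasure_real_Ici_le_succ ha hb hu
      _ ≤ v / u * (v / u) ^ r := by
          refine mul_le_mul ?_ h1 measureReal_nonneg (by positivity)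
          gcongr
      _ = _ := by rw [pow_succ]; ring

/-- The upper tail of a Beta distribution beyond its mean is `o(1 / (a + b))`, uniformly. -/
theorem exists_betaMeasure_real_Ici_le {u v ε : ℝ} (hv : 0 < v) (hvu : v < u) (hε : 0 < ε) :
    ∃ N : ℝ, ∀ a b : ℝ, 0 < a → 0 < b → N ≤ a + b → a ≤ v * (a + b) →
      (a + b) * (betaMeasure a b).real (Set.Ici u) ≤ ε := by
  have hu : 0 < u := hv.trans hvu
  set w := (v + u) / 2 with hw
  have hwu : w < u := by linarith
  have hw0 : 0 < w := by linarith
  set c := w - v with hc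
  have hc0 : 0 < c := by linarith
  have hq0 : 0 ≤ w / u := by positivity
  have hq1 : w / u < 1 := (div_lt_one hu).2 hwu
  have ht : Tendsto (fun r : ℕ => ((r : ℝ) + 1) * (w / u) ^ r) atTop (𝓝 0) := by
    have h := (tendsto_self_mul_const_pow_of_lt_one hq0 hq1).add
      (tendsto_pow_atTop_nhds_zero_of_lt_one hq0 hq1)
    simpa [add_mul] using h
  obtain ⟨R, hR⟩ := eventually_atTop.1 (ht.eventually_le_const (show 0 < c * ε by positivity))
  refine ⟨(R + 1) / c, fun a b ha hb hN hle => ?_⟩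
  set r := ⌊c * (a + b)⌋₊ with hr
  have hn : 0 ≤ c * (a + b) := by positivity
  have h1 : (r : ℝ) ≤ c * (a + b) := Nat.floor_le hn
  have h2 : c * (a + b) < r + 1 := Nat.lt_floor_add_one _
  have h3 : R ≤ r := by
    refine Nat.le_floor ?_
    rw [div_le_iff₀ hc0] at hN
    linarith
  have h4 := betaMeasure_real_Ici_le_pow (v := w) hu r ha hb (by
    rw [hc] at h1; nlinarith)
  have h5 := hR r h3
  have h6 : (0 : ℝ) ≤ (w / u) ^ r := by positivity
  have h7 : c * ((a + b) * (betaMeasure a b).real (Set.Ici u)) ≤ c * ε := by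
    calc c * ((a + b) * (betaMeasure a b).real (Set.Ici u))
        = c * (a + b) * (betaMeasure a b).real (Set.Ici u) := by ring
      _ ≤ (r + 1) * (w / u) ^ r := mul_le_mul h2.le h4 measureReal_nonneg (by positivity)
      _ ≤ _ := h5
  exact le_of_mul_le_mul_left h7 hc0

theorem exists_betaMeasure_real_Iic_le {u v ε : ℝ} (hv : v < 1) (huv : u < v) (hε : 0 < ε) :
    ∃ N : ℝ, ∀ a b : ℝ, 0 < a → 0 < b → N ≤ a + b → v * (a + b) ≤ a →
      (a + b) * (betaMeasure a b).real (Set.Iic u) ≤ ε := by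
  obtain ⟨N, hN⟩ := exists_betaMeasure_real_Ici_le (u := 1 - u) (v := 1 - v) (by linarith)
    (by linarith) hε
  refine ⟨N, fun a b ha hb h1 h2 => ?_⟩
  have h := hN b a hb ha (by linarith) (by linarith)
  rw [measureReal_def, ← betaMeasure_preimage_one_sub a b measurableSet_Ici] at h
  have hs : (fun x : ℝ => 1 - x) ⁻¹' Set.Ici (1 - u) = Set.Iic u := by
    ext x; simp
  rw [hs, add_comm b a] at h
  exact h

/-- Comparison of the density at a point and at its mirror image with respect to `1 / 2`. -/
theorem betaPDFReal_le_mul_one_sub {a b x C : ℝ} (ha : 0 < a) (hb : 0 < b) (h0 : 0 < x) (h1 : x < 1)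
    (h : (x / (1 - x)) ^ (a - b) ≤ C) :
    betaPDFReal a b x ≤ C * betaPDFReal a b (1 - x) := by
  have hx : 0 < 1 - x := by linarith
  have h2 : betaPDFReal a b x = (x / (1 - x)) ^ (a - b) * betaPDFReal a b (1 - x) := by
    rw [betaPDFReal, betaPDFReal, if_pos ⟨h0, h1⟩, if_pos ⟨hx, by linarith⟩,
      Real.div_rpow h0.le hx.le]
    have e1 : x ^ (a - 1) = x ^ (a - b) * x ^ (b - 1) := by
      rw [← Real.rpow_add h0]; congr 1; ring
    have e2 : (1 - x) ^ (a - 1) = (1 - x) ^ (a - b) * (1 - x) ^ (b - 1) := by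
      rw [← Real.rpow_add hx]; congr 1; ring
    have e3 : (1 - x) ^ (a - b) ≠ 0 := (Real.rpow_pos_of_pos hx _).ne'
    rw [sub_sub_cancel, e1, e2]
    field_simp
  rw [h2]
  exact mul_le_mul_of_nonneg_right h (betaPDFReal_nonneg ha hb _)

/-- Chebyshev's inequality around `1 / 2` for a Beta distribution. -/
theorem betaMeasure_real_compl_Ioo_le {a b w : ℝ} (ha : 0 < a) (hb : 0 < b) (hw : 0 < w) :
    (betaMeasure a b).real (Set.Ioo (1 / 2 - w) (1 / 2 + w))ᶜ ≤
      ((a + b) + (a - b) ^ 2) / (4 * (a + b) * (a + b + 1)) / w ^ 2 := by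
  have hP := isProbabilityMeasureBeta ha hb
  have hP' := isProbabilityMeasureBeta (by positivity : 0 < a + 1) (by positivity : 0 < b + 1)
  set c := a * b / ((a + b) * (a + b + 1)) with hc
  have hc0 : 0 < c := by positivity
  -- `E[θ * (1 - θ)]` is read off from the density with both parameters raised by one.
  have hpt : ∀ x, x * (1 - x) * betaPDFReal a b x = c * betaPDFReal (a + 1) (b + 1) x := by
    intro x
    have e1 := one_sub_mul_betaPDFReal ha hb x
    have e2 := mul_betaPDFReal ha (by positivity : 0 < b + 1) x
    calc x * (1 - x) * betaPDFReal a b x = x * ((1 - x) * betaPDFReal a b x) := by ring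
      _ = b / (a + b) * (x * betaPDFReal a (b + 1) x) := by rw [e1]; ring
      _ = _ := by
        rw [e2, hc]
        have : a + b ≠ 0 := by positivity
        have : a + (b + 1) ≠ 0 := by positivity
        field_simp
        ring
  have hint : ∀ {a b : ℝ}, 0 < a → 0 < b → Integrable (betaPDFReal a b) volume ∧
      ∫ x, betaPDFReal a b x = 1 := by
    intro a b ha hb
    have h := lintegral_betaPDF_eq_one ha hb
    have hnn : 0 ≤ᵐ[volume] betaPDFReal a b :=
      Eventually.of_forall (betaPDFReal_nonneg ha hb)
    have hm := (measurable_betaPDFReal a b).aestronglyMeasurable (μ := volume)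
    refine ⟨⟨hm, ?_⟩, ?_⟩
    · rw [hasFiniteIntegral_iff_ofReal hnn]
      change ∫⁻ x, betaPDF a b x < _
      rw [h]; exact ENNReal.one_lt_top
    · rw [integral_eq_lintegral_of_nonneg_ae hnn hm]
      change (∫⁻ x, betaPDF a b x).toReal = 1
      rw [h]; rfl
  obtain ⟨i1, e1⟩ := hint ha hb
  obtain ⟨i2, e2⟩ := hint (by positivity : 0 < a + 1) (by positivity : 0 < b + 1)
  set s := (Set.Ioo (1 / 2 - w) (1 / 2 + w))ᶜ with hs
  have hsm : MeasurableSet s := measurableSet_Ioo.compl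
  have hreal : (betaMeasure a b).real s = ∫ x in s, betaPDFReal a b x := by
    rw [measureReal_def, betaMeasure_apply hsm, integral_eq_lintegral_of_nonneg_ae
      (Eventually.of_forall (betaPDFReal_nonneg ha hb)) i1.aestronglyMeasurable.restrict]
    rfl
  have hsq : ∀ x, (x - 1 / 2) ^ 2 * betaPDFReal a b x =
      1 / 4 * betaPDFReal a b x - c * betaPDFReal (a + 1) (b + 1) x := by
    intro x; rw [← hpt]; ring
  have i3 : Integrable (fun x => (x - 1 / 2) ^ 2 * betaPDFReal a b x) volume := by
    simp_rw [hsq]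
    exact (i1.const_mul _).sub (i2.const_mul _)
  have e3 : ∫ x, (x - 1 / 2) ^ 2 * betaPDFReal a b x = 1 / 4 - c := by
    simp_rw [hsq]
    rw [integral_sub (i1.const_mul _) (i2.const_mul _), integral_const_mul, integral_const_mul,
      e1, e2]
    ring
  have h1 : w ^ 2 * (betaMeasure a b).real s ≤ 1 / 4 - c := by
    rw [hreal, ← integral_const_mul, ← e3]
    calc ∫ x in s, w ^ 2 * betaPDFReal a b x
        ≤ ∫ x in s, (x - 1 / 2) ^ 2 * betaPDFReal a b x := by
          refine setIntegral_mono_on (i1.const_mul _).integrableOn i3.integrableOn hsm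
            fun x hx => ?_
          refine mul_le_mul_of_nonneg_right ?_ (betaPDFReal_nonneg ha hb x)
          rw [hs, Set.mem_compl_iff, Set.mem_Ioo, not_and_or, not_lt, not_lt] at hx
          rcases hx with hx | hx <;> nlinarith
      _ ≤ _ := setIntegral_le_integral i3 (Eventually.of_forall fun x =>
          mul_nonneg (sq_nonneg _) (betaPDFReal_nonneg ha hb x))
  rw [le_div_iff₀ (by positivity), mul_comm]
  refine h1.trans (le_of_eq ?_)
  rw [hc]
  have : a + b ≠ 0 := by positivity
  have : a + b + 1 ≠ 0 := by positivity
  field_simp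
  ring

/-- If the mean exceeds `1 / 2` by at most the order of the standard deviation, that is
`a - b ≤ √(a + b)`, then the distribution charges `(-∞, 1 / 2]` with a fixed positive mass. By
Chebyshev's inequality half of the mass lies within `1 / √(a + b)` of `1 / 2`, and there the
densities at mirror points differ by a bounded factor only. -/
theorem le_betaMeasure_real_Iic_half {a b : ℝ} (ha : 0 < a) (hb : 0 < b) (hn : 16 ≤ a + b)
    (hab : a - b ≤ √(a + b)) : Real.exp (-8) / 4 ≤ (betaMeasure a b).real (Set.Iic (1 / 2)) := by
  have hP := isProbabilityMeasureBeta ha hb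
  set P := betaMeasure a b with hPdef
  set q := √(a + b) with hq
  have hq2 : q ^ 2 = a + b := Real.sq_sqrt (by positivity)
  have hq4 : 4 ≤ q := Real.le_sqrt_of_sq_le (by norm_num; linarith)
  have hhalf : ∀ w C : ℝ, 0 < w → w ≤ 1 / 2 → 0 ≤ C →
      (∀ x, 1 / 2 < x → x < 1 / 2 + w → (x / (1 - x)) ^ (a - b) ≤ C) →
      P.real (Set.Ioo (1 / 2) (1 / 2 + w)) ≤ C * P.real (Set.Iic (1 / 2)) := by
    intro w C hw hw2 hC h
    have h1 := betaMeasure_real_preimage_le ha hb measurePreserving_one_sub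
      (measurableSet_Ioo (a := 1 / 2 - w) (b := (1 / 2 : ℝ))) hC (fun x hx => by
        obtain ⟨hx1, hx2⟩ := hx
        exact betaPDFReal_le_mul_one_sub ha hb (by linarith) (by linarith)
          (h x (by linarith) (by linarith)))
    have hs : (fun x : ℝ => 1 - x) ⁻¹' Set.Ioo (1 / 2 - w) (1 / 2) =
        Set.Ioo (1 / 2) (1 / 2 + w) := by
      ext x; simp only [Set.mem_preimage, Set.mem_Ioo]
      constructor <;> rintro ⟨h1, h2⟩ <;> constructor <;> linarith
    rw [hs] at h1
    refine h1.trans (mul_le_mul_of_nonneg_left (measureReal_mono fun x hx => hx.2.le) hC)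
  have hexp : Real.exp (-8) ≤ 1 := Real.exp_le_one_iff.2 (by norm_num)
  have hexp0 := Real.exp_pos (-8)
  have hone : ∀ w, 0 < w → 1 ≤ P.real (Set.Iic (1 / 2)) + P.real (Set.Ioo (1 / 2) (1 / 2 + w)) +
      P.real (Set.Ioo (1 / 2 - w) (1 / 2 + w))ᶜ := by
    intro w hw
    have hun : (Set.univ : Set ℝ) ⊆ (Set.Iic (1 / 2) ∪ Set.Ioo (1 / 2) (1 / 2 + w)) ∪
        (Set.Ioo (1 / 2 - w) (1 / 2 + w))ᶜ := by
      intro x _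
      by_cases h1 : x ≤ 1 / 2
      · exact Or.inl (Or.inl h1)
      · by_cases h2 : x < 1 / 2 + w
        · exact Or.inl (Or.inr ⟨not_le.1 h1, h2⟩)
        · exact Or.inr fun h => h2 h.2
    calc (1 : ℝ) = P.real Set.univ := by simp
      _ ≤ _ := (measureReal_mono hun).trans ((measureReal_union_le _ _).trans
          (add_le_add_left (measureReal_union_le _ _) _))
  set w := 1 / q with hw
  have hw0 : 0 < w := by positivity
  have hw4 : w ≤ 1 / 4 := one_div_le_one_div_of_le (by norm_num) hq4
  have hwq : w * q = 1 := by rw [hw]; field_simp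
  rcases le_total a b with hle | hle
  · have h1 := hhalf (1 / 2) 1 (by norm_num) le_rfl zero_le_one fun x hx1 hx2 => by
      refine Real.rpow_le_one_of_one_le_of_nonpos ?_ (by linarith)
      rw [le_div_iff₀ (by linarith)]; linarith
    have h2 : P.real (Set.Ioo (1 / 2 - 1 / 2) (1 / 2 + 1 / 2))ᶜ = 0 := by
      rw [measureReal_def, hPdef, betaMeasure_apply measurableSet_Ioo.compl]
      rw [setLIntegral_eq_zero measurableSet_Ioo.compl]
      · rfl
      · intro x hx
        rw [betaPDF_eq, if_neg fun h => hx ⟨by linarith [h.1], by linarith [h.2]⟩]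
        simp
    have h3 := hone (1 / 2) (by norm_num)
    linarith
  · have h1 := hhalf w (Real.exp 8) hw0 (by linarith) (Real.exp_pos _).le fun x hx1 hx2 => by
      have hx : 0 < 1 - x := by linarith
      have e1 : x / (1 - x) ≤ Real.exp (8 * w) := by
        refine le_trans ?_ (Real.add_one_le_exp _)
        rw [div_le_iff₀ hx]
        nlinarith
      calc (x / (1 - x)) ^ (a - b) ≤ (Real.exp (8 * w)) ^ (a - b) :=
            Real.rpow_le_rpow (by positivity) e1 (by linarith)
        _ = Real.exp (8 * w * (a - b)) := (Real.exp_mul _ _).symm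
        _ ≤ Real.exp 8 := by
            refine Real.exp_le_exp.2 ?_
            calc 8 * w * (a - b) ≤ 8 * w * q := by gcongr
              _ = 8 := by rw [mul_assoc, hwq]; norm_num
    have h2 : P.real (Set.Ioo (1 / 2 - w) (1 / 2 + w))ᶜ ≤ 1 / 2 := by
      refine (betaMeasure_real_compl_Ioo_le ha hb hw0).trans ?_
      have hd : (a - b) ^ 2 ≤ a + b := by
        rw [← hq2]
        exact pow_le_pow_left₀ (by linarith) hab 2
      have hw2 : w ^ 2 = 1 / (a + b) := by rw [hw, div_pow, hq2, one_pow]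
      have hpos : 0 < a + b := by positivity
      rw [hw2]
      rw [div_div_eq_mul_div, div_one, div_mul_eq_mul_div, div_le_div_iff₀ (by positivity) two_pos]
      nlinarith
    have h3 := hone w hw0
    have h4 : 1 / 2 ≤ (1 + Real.exp 8) * P.real (Set.Iic (1 / 2)) := by linarith
    have h5 : Real.exp (-8) * Real.exp 8 = 1 := by rw [← Real.exp_add]; simp
    have h6 : (0 : ℝ) ≤ P.real (Set.Iic (1 / 2)) := measureReal_nonneg
    nlinarith [mul_le_mul_of_nonneg_left h4 hexp0.le]

/-- A Beta distribution whose second parameter exceeds the first by at most `d` charges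
`(1 / 2, ∞)` with a mass bounded below in terms of `d` only: the mass of `(1 / 4, 1 / 2]` is
compared with that of its mirror image, and the mass of `(0, 1 / 4]` with that of its translate by
`1 / 2`. -/
theorem le_betaMeasure_real_Ioi_half {a b d : ℝ} (ha : 1 ≤ a) (hb : 0 < b) (hd : 0 ≤ d)
    (hab : b ≤ a + d) :
    1 / (1 + (4 : ℝ) ^ d + 3 ^ d) ≤ (betaMeasure a b).real (Set.Ioi (1 / 2)) := by
  have ha0 : 0 < a := by linarith
  have hP := isProbabilityMeasureBeta ha0 hb
  set P := betaMeasure a b with hPdef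
  have h3 : (1 : ℝ) ≤ 3 ^ d := Real.one_le_rpow (by norm_num) hd
  have h4 : (1 : ℝ) ≤ 4 ^ d := Real.one_le_rpow (by norm_num) hd
  have hQ : (0 : ℝ) ≤ P.real (Set.Ioi (1 / 2)) := measureReal_nonneg
  have hA : P.real (Set.Ioc (1 / 4) (1 / 2)) ≤ 3 ^ d * P.real (Set.Ici (1 / 2)) := by
    have h1 := betaMeasure_real_preimage_le ha0 hb measurePreserving_one_sub
      (measurableSet_Ico (a := (1 / 2 : ℝ)) (b := 3 / 4)) (C := 3 ^ d) (by positivity)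
      (fun x hx => by
        obtain ⟨hx1, hx2⟩ := hx
        have hx3 : 0 < x := by linarith
        refine betaPDFReal_le_mul_one_sub ha0 hb hx3 (by linarith) ?_
        rw [← inv_div, Real.inv_rpow (by apply div_nonneg <;> linarith),
          ← Real.rpow_neg (by apply div_nonneg <;> linarith), neg_sub]
        have e1 : 1 ≤ (1 - x) / x := by rw [le_div_iff₀ hx3]; linarith
        have e2 : (1 - x) / x ≤ 3 := by rw [div_le_iff₀ hx3]; linarith
        calc ((1 - x) / x) ^ (b - a) ≤ ((1 - x) / x) ^ d :=
              Real.rpow_le_rpow_of_exponent_le e1 (by linarith)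
          _ ≤ 3 ^ d := Real.rpow_le_rpow (by linarith) e2 hd)
    have hs : (fun x : ℝ => 1 - x) ⁻¹' Set.Ico (1 / 2) (3 / 4) = Set.Ioc (1 / 4) (1 / 2) := by
      ext x; simp only [Set.mem_preimage, Set.mem_Ico, Set.mem_Ioc]
      constructor <;> rintro ⟨h1, h2⟩ <;> constructor <;> linarith
    rw [hs] at h1
    exact h1.trans (mul_le_mul_of_nonneg_left (measureReal_mono fun x hx => hx.1) (by positivity))
  have hB : P.real (Set.Ioc 0 (1 / 4)) ≤ 4 ^ d * P.real (Set.Ioi (1 / 2)) := by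
    have h1 := betaMeasure_real_preimage_le ha0 hb
      (measurePreserving_add_right (volume : Measure ℝ) (1 / 2))
      (measurableSet_Ioc (a := (1 / 2 : ℝ)) (b := 3 / 4)) (C := 4 ^ d) (by positivity)
      (fun x hx => by
        obtain ⟨hx1, hx2⟩ := hx
        have hx0 : 0 < x := by linarith
        have hx4 : x ≤ 1 / 4 := by linarith
        have hy : 0 < 1 / 2 - x := by linarith
        have hz : 0 < 1 - x := by linarith
        have hB := beta_pos ha0 hb
        rw [betaPDFReal, betaPDFReal, if_pos ⟨hx0, by linarith⟩, if_pos ⟨by linarith, by linarith⟩]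
        have e0 : 1 - (x + 1 / 2) = 1 / 2 - x := by ring
        have e1 : (1 - x) ^ (b - 1) = (1 - x) ^ (a - 1) * (1 - x) ^ (b - a) := by
          rw [← Real.rpow_add hz]; congr 1; ring
        have e2 : (1 / 2 - x) ^ (b - 1) = (1 / 2 - x) ^ (a - 1) * (1 / 2 - x) ^ (b - a) := by
          rw [← Real.rpow_add hy]; congr 1; ring
        have e3 : x ^ (a - 1) * (1 - x) ^ (a - 1) ≤
            (x + 1 / 2) ^ (a - 1) * (1 / 2 - x) ^ (a - 1) := by
          rw [← Real.mul_rpow hx0.le hz.le, ← Real.mul_rpow (by linarith) hy.le]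
          exact Real.rpow_le_rpow (by positivity) (by nlinarith) (by linarith)
        have e4 : (1 - x) ^ (b - a) ≤ 4 ^ d * (1 / 2 - x) ^ (b - a) := by
          have f1 : 1 ≤ (1 - x) / (1 / 2 - x) := by rw [le_div_iff₀ hy]; linarith
          have f2 : (1 - x) / (1 / 2 - x) ≤ 4 := by rw [div_le_iff₀ hy]; linarith
          rw [← div_le_iff₀ (Real.rpow_pos_of_pos hy _), ← Real.div_rpow hz.le hy.le]
          calc ((1 - x) / (1 / 2 - x)) ^ (b - a) ≤ ((1 - x) / (1 / 2 - x)) ^ d :=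
                Real.rpow_le_rpow_of_exponent_le f1 (by linarith)
            _ ≤ 4 ^ d := Real.rpow_le_rpow (by linarith) f2 hd
        rw [e0, e1, e2]
        have p1 : 0 ≤ (x + 1 / 2) ^ (a - 1) * (1 / 2 - x) ^ (a - 1) := by positivity
        have p2 : 0 ≤ (1 - x) ^ (b - a) := by positivity
        calc 1 / beta a b * x ^ (a - 1) * ((1 - x) ^ (a - 1) * (1 - x) ^ (b - a))
            = 1 / beta a b * ((x ^ (a - 1) * (1 - x) ^ (a - 1)) * (1 - x) ^ (b - a)) := by ring
          _ ≤ 1 / beta a b * (((x + 1 / 2) ^ (a - 1) * (1 / 2 - x) ^ (a - 1)) *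
                (4 ^ d * (1 / 2 - x) ^ (b - a))) := by gcongr
          _ = _ := by ring)
    have hs : (fun x : ℝ => x + 1 / 2) ⁻¹' Set.Ioc (1 / 2) (3 / 4) = Set.Ioc 0 (1 / 4) := by
      ext x; simp only [Set.mem_preimage, Set.mem_Ioc]
      constructor <;> rintro ⟨h1, h2⟩ <;> constructor <;> linarith
    rw [hs] at h1
    exact h1.trans (mul_le_mul_of_nonneg_left (measureReal_mono fun x hx => hx.1) (by positivity))
  have hIci : P.real (Set.Ici (1 / 2)) = P.real (Set.Ioi (1 / 2)) := by
    have hac : P ≪ volume := withDensity_absolutelyContinuous _ _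
    exact measureReal_congr (hac.ae_eq Ioi_ae_eq_Ici.symm)
  have hneg : P.real (Set.Iic 0) = 0 := by
    rw [measureReal_def, hPdef, betaMeasure_apply measurableSet_Iic,
      setLIntegral_eq_zero measurableSet_Iic fun x hx => betaPDF_eq_zero_of_nonpos hx]
    rfl
  have hun : (Set.univ : Set ℝ) ⊆ ((Set.Iic 0 ∪ Set.Ioc 0 (1 / 4)) ∪ Set.Ioc (1 / 4) (1 / 2)) ∪
      Set.Ioi (1 / 2) := by
    intro x _
    rcases le_or_gt x (1 / 2) with h | h
    · rcases le_or_gt x (1 / 4) with h' | h'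
      · rcases le_or_gt x 0 with h'' | h''
        · exact Or.inl (Or.inl (Or.inl h''))
        · exact Or.inl (Or.inl (Or.inr ⟨h'', h'⟩))
      · exact Or.inl (Or.inr ⟨h', h⟩)
    · exact Or.inr h
  have htot : (1 : ℝ) ≤ P.real (Set.Iic 0) + P.real (Set.Ioc 0 (1 / 4)) +
      P.real (Set.Ioc (1 / 4) (1 / 2)) + P.real (Set.Ioi (1 / 2)) := by
    calc (1 : ℝ) = P.real Set.univ := by simp
      _ ≤ _ := (measureReal_mono hun).trans ((measureReal_union_le _ _).trans
          (add_le_add_left ((measureReal_union_le _ _).trans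
            (add_le_add_left (measureReal_union_le _ _) _)) _))
  rw [hIci] at hA
  rw [div_le_iff₀ (by positivity)]
  linarith

end IndSelfSparring

/-! ### Selection probabilities -/

namespace IndSelfSparring

variable {K : ℕ}

/-- The posterior law of the sample `θ i` of arm `i`. -/
noncomputable def posterior (D : Stats K) (i : Fin K) : Measure ℝ :=
  betaMeasure (D.S i + 1) (D.F i + 1)

instance (D : Stats K) (i : Fin K) : IsProbabilityMeasure (posterior D i) := by
  unfold posterior; infer_instance

theorem sampleLaw_real_pi (D : Stats K) (s : Fin K → Set ℝ) :
    (sampleLaw D).real (Set.univ.pi s) = ∏ i, (posterior D i).real (s i) := by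
  rw [measureReal_def, sampleLaw, Measure.pi_pi, ENNReal.toReal_prod]
  rfl

theorem sampleLaw_real_eval (D : Stats K) (i : Fin K) {s : Set ℝ} (hs : MeasurableSet s) :
    (sampleLaw D).real {θ | θ i ∈ s} = (posterior D i).real s := by
  have h := (measurePreserving_eval (fun i => posterior D i) i).measure_preimage
    hs.nullMeasurableSet
  rw [measureReal_def, measureReal_def, ← h]
  rfl

theorem sampleLaw_real_pair (D : Stats K) {i j : Fin K} (hij : i ≠ j) (s t : Set ℝ) :
    (sampleLaw D).real {θ | θ i ∈ s ∧ θ j ∈ t} =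
      (posterior D i).real s * (posterior D j).real t := by
  have hs : {θ : Fin K → ℝ | θ i ∈ s ∧ θ j ∈ t} =
      Set.univ.pi fun l => if l = i then s else if l = j then t else Set.univ := by
    ext θ
    simp only [Set.mem_ofPred_eq, Set.mem_pi, Set.mem_univ, true_implies]
    constructor
    · rintro ⟨h1, h2⟩ l
      split_ifs with h3 h4
      · subst h3; exact h1
      · subst h4; exact h2
      · trivial
    · intro h
      exact ⟨by simpa using h i, by simpa [hij.symm] using h j⟩
  rw [hs, sampleLaw_real_pi, ← Finset.mul_prod_erase _ _ (Finset.mem_univ i),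
    ← Finset.mul_prod_erase _ _ (Finset.mem_erase.2 ⟨hij.symm, Finset.mem_univ j⟩),
    Finset.prod_eq_one]
  · simp [hij.symm]
  · intro l hl
    simp only [Finset.mem_erase, Finset.mem_univ, and_true] at hl
    simp [hl.1, hl.2]

variable [NeZero K]

theorem selProb_eq (D : Stats K) (i : Fin K) :
    selProb D i = (sampleLaw D).real {θ | argmax θ = i} := by
  rw [selProb, selectLaw, map_measureReal_apply measurable_argmax (measurableSet_singleton i)]
  rfl

theorem le_argmax (θ : Fin K → ℝ) (k : Fin K) : θ k ≤ θ (argmax θ) :=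
  ((argmax_eq_iff θ _).1 rfl).1 k

theorem measurableSet_argmax (i : Fin K) : MeasurableSet {θ : Fin K → ℝ | argmax θ = i} :=
  measurable_argmax (measurableSet_singleton i)

/-- An arm is not selected when its sample is at most `1 / 2` and the sample of another arm
exceeds `1 / 2`. -/
theorem selProb_le_one_sub (D : Stats K) {i k : Fin K} (h : i ≠ k) :
    selProb D k ≤ 1 - (posterior D i).real (Set.Ioi (1 / 2)) *
      (posterior D k).real (Set.Iic (1 / 2)) := by
  rw [← sampleLaw_real_pair D h, selProb_eq, le_sub_iff_add_le]
  rw [← measureReal_union' _ (measurableSet_argmax k)]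
  · exact measureReal_le_one
  · rw [Set.disjoint_left]
    rintro θ h1 ⟨h2, h3⟩
    have h4 := le_argmax θ i
    rw [h1] at h4
    simp only [Set.mem_Ioi, Set.mem_Iic] at h2 h3
    linarith

/-- If arm `j` is selected, then its sample is at least `u`, or the samples of all arms, such as
`i`, are below `u`. -/
theorem selProb_le_add (D : Stats K) (i j : Fin K) (u : ℝ) :
    selProb D j ≤ (posterior D j).real (Set.Ici u) + (posterior D i).real (Set.Iic u) := by
  rw [← sampleLaw_real_eval D j measurableSet_Ici, ← sampleLaw_real_eval D i measurableSet_Iic,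
    selProb_eq]
  refine (measureReal_mono ?_).trans (measureReal_union_le _ _)
  intro θ h1
  have h4 := le_argmax θ i
  rw [h1] at h4
  rcases le_or_gt u (θ j) with h | h
  · exact Or.inl h
  · exact Or.inr (h4.trans h.le)

/-- If arm `j` is selected although its sample is below `u`, then all samples are below `u`. This
constrains the samples of the arms other than `i` independently of the sample of `i`, and if the
latter exceeds `u`, then `i` is selected. -/
theorem mul_selProb_sub_le (D : Stats K) (i j : Fin K) (u : ℝ) :
    (posterior D i).real (Set.Ioi u) * (selProb D j - (posterior D j).real (Set.Ici u)) ≤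
      selProb D i := by
  set q : ℝ := ∏ l ∈ Finset.univ.erase i, (posterior D l).real (Set.Iic u) with hq
  have h1 : selProb D j - (posterior D j).real (Set.Ici u) ≤ q := by
    rw [sub_le_iff_le_add', selProb_eq, ← sampleLaw_real_eval D j measurableSet_Ici]
    have h2 : q = (sampleLaw D).real
        (Set.univ.pi fun l => if l = i then Set.univ else Set.Iic u) := by
      rw [sampleLaw_real_pi, ← Finset.mul_prod_erase _ _ (Finset.mem_univ i)]
      simp only [if_true, probReal_univ, one_mul]
      exact Finset.prod_congr rfl fun l hl => by rw [if_neg (Finset.ne_of_mem_erase hl)]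
    rw [h2]
    refine (measureReal_mono ?_).trans (measureReal_union_le _ _)
    intro θ h3
    rcases le_or_gt u (θ j) with h | h
    · exact Or.inl h
    · refine Or.inr fun l _ => ?_
      have h4 := le_argmax θ l
      rw [h3] at h4
      simp only
      split_ifs
      · trivial
      · exact h4.trans h.le
  have h2 : (posterior D i).real (Set.Ioi u) * q ≤ selProb D i := by
    have h3 : (posterior D i).real (Set.Ioi u) * q = (sampleLaw D).real
        (Set.univ.pi fun l => if l = i then Set.Ioi u else Set.Iic u) := by
      rw [sampleLaw_real_pi, ← Finset.mul_prod_erase _ _ (Finset.mem_univ i)]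
      simp only [if_true]
      congr 1
      exact Finset.prod_congr rfl fun l hl => by rw [if_neg (Finset.ne_of_mem_erase hl)]
    rw [h3, selProb_eq]
    refine measureReal_mono fun θ hθ => ?_
    by_contra hne
    have h5 := hθ i trivial
    have h6 := hθ (argmax θ) trivial
    have hne' : argmax θ ≠ i := hne
    simp only [if_true, if_neg hne', Set.mem_Ioi, Set.mem_Iic] at h5 h6
    have := le_argmax θ i
    linarith
  exact (mul_le_mul_of_nonneg_left h1 measureReal_nonneg).trans h2

omit [NeZero K] in
/-- The parameters of the posterior in terms of `plays` and `net`. -/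
theorem posterior_param (D : Stats K) (i : Fin K) :
    ((D.S i : ℝ) + 1) + (D.F i + 1) = D.plays i + 2 ∧
      ((D.S i : ℝ) + 1) - (D.F i + 1) = D.net i := by
  unfold Stats.plays Stats.net
  constructor <;> ring

omit [NeZero K] in
/-- The posterior of an arm whose empirical mean is below `1 / 2` by a margin is concentrated
below `1 / 2 - κ / 8`. -/
theorem exists_posterior_Ici_le {κ C ε : ℝ} (hκ : 0 < κ) (hκ1 : κ ≤ 1) (hε : 0 < ε) :
    ∃ N : ℝ, ∀ (D : Stats K) (i : Fin K), N ≤ D.plays i → D.net i ≤ C - κ * D.plays i →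
      (D.plays i + 2) * (posterior D i).real (Set.Ici (1 / 2 - κ / 8)) ≤ ε := by
  obtain ⟨N, hN⟩ := exists_betaMeasure_real_Ici_le (u := 1 / 2 - κ / 8) (v := 1 / 2 - κ / 4)
    (by linarith) (by linarith) hε
  refine ⟨max N ((C + 2 * κ) * 2 / κ), fun D i h1 h2 => ?_⟩
  obtain ⟨e1, e2⟩ := posterior_param D i
  have h3 := (le_max_left _ _).trans h1
  have h4 := (le_max_right _ _).trans h1
  rw [div_le_iff₀ hκ] at h4
  have h5 := hN (D.S i + 1) (D.F i + 1) (by positivity) (by positivity) (by linarith) (by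
    rw [e1]; nlinarith)
  rwa [e1] at h5

omit [NeZero K] in
theorem exists_posterior_Iic_le {u v C ε : ℝ} (hv : v < 1 / 2) (huv : u < v) (hε : 0 < ε) :
    ∃ N : ℝ, ∀ (D : Stats K) (i : Fin K), N ≤ D.plays i → -C ≤ D.net i →
      (D.plays i + 2) * (posterior D i).real (Set.Iic u) ≤ ε := by
  obtain ⟨N, hN⟩ := exists_betaMeasure_real_Iic_le (u := u) (v := v)
    (by linarith) huv hε
  have hv' : 0 < 1 / 2 - v := by linarith
  refine ⟨max N (C / 2 / (1 / 2 - v)), fun D i h1 h2 => ?_⟩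
  obtain ⟨e1, e2⟩ := posterior_param D i
  have h3 := (le_max_left _ _).trans h1
  have h4 := (le_max_right _ _).trans h1
  rw [div_le_iff₀ hv'] at h4
  have h5 := hN (D.S i + 1) (D.F i + 1) (by positivity) (by positivity) (by linarith) (by
    rw [e1]; nlinarith)
  rwa [e1] at h5

omit [NeZero K] in
theorem le_posterior_Ioi_half {C : ℝ} (hC : 0 ≤ C) (D : Stats K) (i : Fin K)
    (h : -C ≤ D.net i) :
    1 / (1 + (4 : ℝ) ^ C + 3 ^ C) ≤ (posterior D i).real (Set.Ioi (1 / 2)) :=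
  le_betaMeasure_real_Ioi_half (by simp) (by positivity) hC
    (by linarith [(posterior_param D i).2])

omit [NeZero K] in
theorem le_posterior_Iic_half (D : Stats K) (i : Fin K) (hn : 14 ≤ D.plays i)
    (h : D.net i ≤ √(D.plays i)) :
    Real.exp (-8) / 4 ≤ (posterior D i).real (Set.Iic (1 / 2)) := by
  obtain ⟨e1, e2⟩ := posterior_param D i
  refine le_betaMeasure_real_Iic_half (by positivity) (by positivity) (by linarith) ?_
  rw [e1, e2]
  exact h.trans (Real.sqrt_le_sqrt (by linarith))

/-- If arm `i` has not fallen behind and the surplus of another arm `k` is at most the order of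
its standard deviation, then the selection probability of `k` is bounded away from `1`. -/
theorem exists_selProb_le_one_sub {C : ℝ} (hC : 0 ≤ C) :
    ∃ ρ : ℝ, 0 < ρ ∧ ∀ (D : Stats K) (i k : Fin K), i ≠ k → -C ≤ D.net i → 14 ≤ D.plays k →
      D.net k ≤ √(D.plays k) → selProb D k ≤ 1 - ρ := by
  refine ⟨1 / (1 + (4 : ℝ) ^ C + 3 ^ C) * (Real.exp (-8) / 4), by positivity,
    fun D i k hik h1 h2 h3 => (selProb_le_one_sub D hik).trans ?_⟩
  have := mul_le_mul (le_posterior_Ioi_half hC D i h1) (le_posterior_Iic_half D k h2 h3)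
    (by positivity) measureReal_nonneg
  linarith

/-- While an arm `k` leads by a positive surplus, an arm `j` with a linearly decreasing surplus
that has been played at least of the order of the square root of the number of duels of `k` has
negligible selection probability. -/
theorem exists_selProb_le_div_sqrt {κ C ε ε' : ℝ} (hκ : 0 < κ) (hκ1 : κ ≤ 1) (hε : 0 < ε)
    (hε' : 0 < ε') :
    ∃ N : ℝ, ∀ (D : Stats K) (j k : Fin K), D.net j ≤ C - κ * D.plays j → 0 ≤ D.net k →
      N ≤ D.plays k → ε' * √(D.plays k) ≤ D.plays j →
      selProb D j ≤ ε / √(D.plays k + 1) := by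
  obtain ⟨N₁, hN₁⟩ := exists_posterior_Ici_le (K := K) (C := C) hκ hκ1
    (show 0 < ε * ε' / 4 by positivity)
  obtain ⟨N₂, hN₂⟩ := exists_posterior_Iic_le (K := K) (u := 1 / 2 - κ / 8) (v := 1 / 2 - κ / 16)
    (C := 0) (by linarith) (by linarith) (show 0 < ε / 2 by positivity)
  refine ⟨max (max 1 N₂) ((N₁ / ε') ^ 2), fun D j k hj hk hn hjk => ?_⟩
  have h1 : 1 ≤ D.plays k := (le_max_left _ _).trans ((le_max_left _ _).trans hn)
  have h2 : N₂ ≤ D.plays k := (le_max_right _ _).trans ((le_max_left _ _).trans hn)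
  have h3 : N₁ ≤ D.plays j := by
    refine le_trans ?_ hjk
    have h := Real.le_sqrt_of_sq_le ((le_max_right _ _).trans hn)
    rw [div_le_iff₀ hε'] at h
    linarith
  have hs0 : 0 < √(D.plays k) := Real.sqrt_pos.2 (by linarith)
  have hs1 : √(D.plays k + 1) ≤ 2 * √(D.plays k) := by
    rw [Real.sqrt_le_left (by positivity), mul_pow, Real.sq_sqrt (by linarith)]
    linarith
  have hs2 : 0 < √(D.plays k + 1) := Real.sqrt_pos.2 (by linarith)
  have hs3 : √(D.plays k + 1) ≤ D.plays k + 2 := by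
    rw [Real.sqrt_le_left (by linarith)]
    nlinarith
  have hp1 := hN₁ D j h3 hj
  have hp2 := hN₂ D k h2 (by simpa using hk)
  have hq1 : (posterior D j).real (Set.Ici (1 / 2 - κ / 8)) ≤ ε / 2 / √(D.plays k + 1) := by
    rw [le_div_iff₀ hs2]
    set y := (posterior D j).real (Set.Ici (1 / 2 - κ / 8)) with hy
    have hy0 : 0 ≤ y := measureReal_nonneg
    have e1 : ε' * √(D.plays k) * y ≤ ε * ε' / 4 :=
      le_trans (mul_le_mul_of_nonneg_right (by linarith) hy0) hp1
    have e2 : √(D.plays k) * y ≤ ε / 4 := by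
      refine le_of_mul_le_mul_left (a := ε') ?_ hε'
      calc ε' * (√(D.plays k) * y) = ε' * √(D.plays k) * y := by ring
        _ ≤ ε * ε' / 4 := e1
        _ = ε' * (ε / 4) := by ring
    nlinarith [mul_le_mul_of_nonneg_left hs1 hy0]
  have hq2 : (posterior D k).real (Set.Iic (1 / 2 - κ / 8)) ≤ ε / 2 / √(D.plays k + 1) := by
    rw [le_div_iff₀ hs2, mul_comm]
    exact le_trans (mul_le_mul_of_nonneg_right hs3 measureReal_nonneg) hp2
  refine (selProb_le_add D k j (1 / 2 - κ / 8)).trans ((add_le_add hq1 hq2).trans (le_of_eq ?_))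
  ring

end IndSelfSparring

/-! ### Almost sure bounds on the surpluses -/

namespace IndSelfSparring

variable {K m : ℕ}

/-- The preferences between distinct arms are bounded away from `0`. -/
theorem exists_gap (B : DuelingBandit K) :
    ∃ δ : ℝ, 0 < δ ∧ δ ≤ 1 / 4 ∧ ∀ i k, i < k → δ ≤ B.φ i k := by
  classical
  set s := (Finset.univ : Finset (Fin K × Fin K)).filter fun p => p.1 < p.2 with hs
  rcases s.eq_empty_or_nonempty with h | h
  · refine ⟨1 / 4, by norm_num, le_rfl, fun i k hik => ?_⟩
    have : (i, k) ∈ s := by simp [hs, hik]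
    rw [h] at this; simp at this
  · obtain ⟨p, hp, hmin⟩ := s.exists_min_image (fun p => B.φ p.1 p.2) h
    have hp' : p.1 < p.2 := by simpa [hs] using hp
    refine ⟨min (1 / 4) (B.φ p.1 p.2), lt_min (by norm_num) ((B.pos_iff _ _).2 hp'),
      min_le_left _ _, fun i k hik => (min_le_right _ _).trans (hmin (i, k) ?_)⟩
    simp [hs, hik]

theorem net_stats (η : ℝ≥0) (G : ℕ → SimpleGraph (Fin m)) (x : ℕ → Round K m) (k : Fin K) :
    ∀ T, (stats η G x T).net k = η * ∑ t ∈ Finset.range T, ∑ i, duelGain (G t) (x t) k i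
  | 0 => by simp [stats, Stats.init, Stats.net]
  | T + 1 => by
    rw [stats, net_update, net_stats η G x k T, Finset.sum_range_succ]; ring

theorem plays_stats (η : ℝ≥0) (G : ℕ → SimpleGraph (Fin m)) (x : ℕ → Round K m) (k : Fin K) :
    ∀ T, (stats η G x T).plays k = η * ∑ t ∈ Finset.range T, ∑ i, duelCount (G t) (x t) k i
  | 0 => by simp [stats, Stats.init, Stats.plays]
  | T + 1 => by
    rw [stats, plays_update, plays_stats η G x k T, Finset.sum_range_succ]; ring

theorem plays_stats_succ (η : ℝ≥0) (G : ℕ → SimpleGraph (Fin m)) (x : ℕ → Round K m)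
    (k : Fin K) (T : ℕ) : (stats η G x (T + 1)).plays k =
      (stats η G x T).plays k + η * ∑ i, duelCount (G T) (x T) k i := by
  rw [stats, plays_update]

theorem monotone_plays (η : ℝ≥0) (G : ℕ → SimpleGraph (Fin m)) (x : ℕ → Round K m)
    (k : Fin K) : Monotone fun T => (stats η G x T).plays k := by
  refine monotone_nat_of_le_succ fun T => ?_
  rw [plays_stats_succ]
  have : 0 ≤ η * ∑ i, duelCount (G T) (x T) k i :=
    mul_nonneg η.coe_nonneg (Finset.sum_nonneg fun i _ => duelCount_nonneg _ _ _ _)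
  linarith

variable [NeZero K]

/-- The probability that a given slot is filled with an arm worse than `k`. -/
noncomputable def worseProb (D : Stats K) (k : Fin K) : ℝ :=
  ∑ i, if k < i then selProb D i else 0

/-- The best arm never falls behind: its surplus is bounded below. -/
theorem ae_exists_le_net_zero (B : DuelingBandit K) (η : ℝ≥0) (G : ℕ → SimpleGraph (Fin m)) :
    ∀ᵐ x ∂runLaw B η G, ∃ C : ℝ, ∀ T, -C ≤ (stats η G x T).net 0 := by
  obtain ⟨δ, hδ, hδ4, hgap⟩ := exists_gap B
  have h := ae_bddAbove_duels B η G 0 (fun _ i => if i = 0 then 0 else -1) (fun _ _ => 0)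
    (fun _ => 0) hδ (fun _ i => by split_ifs <;> simp) (by simp) (by simp) (fun D => by
      simp only [add_zero, abs_zero]
      rw [Finset.mul_sum]
      refine Finset.sum_le_sum fun i _ => ?_
      have hp := selProb_nonneg D i
      split_ifs with hi
      · simp
      · have := hgap 0 i (Fin.pos_iff_ne_zero.2 hi)
        simp only [abs_neg, abs_one]
        nlinarith)
  filter_upwards [h] with x ⟨C, hC⟩
  refine ⟨η * C, fun T => ?_⟩
  rw [net_stats, ← mul_neg]
  refine mul_le_mul_of_nonneg_left ?_ η.coe_nonneg
  rw [neg_le, ← Finset.sum_neg_distrib]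
  refine le_trans (le_of_eq (Finset.sum_congr rfl fun t _ => ?_)) (hC T)
  rw [← Finset.sum_neg_distrib]
  simp only [zero_mul, add_zero]
  refine Finset.sum_congr rfl fun i _ => ?_
  split_ifs with hi
  · rw [hi, duelGain_self]; simp
  · ring

/-- The accumulated selection probability of an arm is controlled by its number of duels. This is
where every round needs to contain a duel. -/
theorem ae_exists_sum_selProb_le (B : DuelingBandit K) {η : ℝ≥0} (hη : 0 < η)
    (G : ℕ → SimpleGraph (Fin m)) (hG : ∀ t, G t ≠ ⊥) (k : Fin K) :
    ∀ᵐ x ∂runLaw B η G, ∃ C : ℝ, ∀ T, ∑ t ∈ Finset.range T, selProb (stats η G x t) k ≤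
      C + 2 / η * (stats η G x T).plays k := by
  have h := ae_bddAbove_duels B η G k (fun _ _ => 0) (fun _ _ => -1)
    (fun _ => 1 / 2) (κ := 1 / 3) (by norm_num) (by simp) (by simp) (by norm_num [abs_of_pos])
    (fun D => by
      simp only [mul_zero, zero_mul, zero_add, abs_zero, abs_neg, abs_one, mul_neg, mul_one,
        Finset.sum_neg_distrib, sum_selProb]
      rw [abs_of_pos (by norm_num : (0 : ℝ) < 1 / 2)]
      norm_num)
  have hη' : (0 : ℝ) < η := hη
  filter_upwards [h] with x ⟨C, hC⟩
  refine ⟨2 * C, fun T => ?_⟩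
  rw [plays_stats, ← mul_assoc, div_mul_cancel₀ _ hη'.ne', ← sub_le_iff_le_add]
  refine le_trans ?_ (mul_le_mul_of_nonneg_left (hC T) zero_le_two)
  rw [Finset.mul_sum, Finset.mul_sum, ← Finset.sum_sub_distrib]
  refine Finset.sum_le_sum fun t _ => ?_
  simp only [zero_mul, zero_add, neg_mul, one_mul, Finset.sum_neg_distrib]
  have := mul_le_mul_of_nonneg_right (one_le_dartCount (G t) (hG t))
    (selProb_nonneg (stats η G x t) k)
  linarith

/-- Consider the rounds where arm `k` does not lead by more than `√(plays k)`, is selected with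
probability at most `1 - ρ`, and the worse arms are hardly selected. Then a better arm is selected
with probability of order `ρ`, and the surplus of `k` decreases in proportion to its duels. -/
theorem exists_ae_exists_calm_sum_le (B : DuelingBandit K) (η : ℝ≥0) (G : ℕ → SimpleGraph (Fin m))
    (k : Fin K) {ρ : ℝ} (hρ : 0 < ρ) (hρ1 : ρ ≤ 1) :
    ∃ ε : ℝ, 0 < ε ∧ ε ≤ 1 ∧ ∀ᵐ x ∂runLaw B η G, ∃ C : ℝ, ∀ T, ∑ t ∈ Finset.range T,
      (if (stats η G x t).net k ≤ √((stats η G x t).plays k) ∧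
          selProb (stats η G x t) k ≤ 1 - ρ ∧ worseProb (stats η G x t) k ≤ ε then
        ∑ i, (duelGain (G t) (x t) k i + ε * duelCount (G t) (x t) k i) else 0) ≤ C := by
  obtain ⟨δ, hδ, hδ4, hgap⟩ := exists_gap B
  have hε : 0 < δ * ρ / 4 := by positivity
  have hε1 : δ * ρ / 4 ≤ 1 := by nlinarith
  refine ⟨δ * ρ / 4, hε, hε1, ?_⟩
  set ε := δ * ρ / 4 with hεdef
  set s : Stats K → Prop := fun D => D.net k ≤ √(D.plays k) ∧ selProb D k ≤ 1 - ρ ∧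
    worseProb D k ≤ ε with hs
  classical
  have h := ae_bddAbove_duels B η G k (fun D i => if s D then (if i = k then 0 else 1) else 0)
    (fun D _ => if s D then ε else 0) (fun _ => 0) hε
    (fun D i => by split_ifs <;> simp)
    (fun D i => by
      split_ifs
      · rwa [abs_of_pos hε]
      · simp) (by simp) (fun D => by
      by_cases hD : s D
      · simp only [if_pos hD, add_zero, abs_zero]
        obtain ⟨-, h1, h2⟩ := hD
        have hL : ∑ i, selProb D i * (2 * (if i = k then 0 else 1) * B.φ k i + ε) ≤
            (ε - 2 * δ) + 2 * δ * selProb D k + 2 * worseProb D k := by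
          have e : (ε - 2 * δ) + 2 * δ * selProb D k + 2 * worseProb D k =
              ∑ i, (selProb D i * (ε - 2 * δ) + (if i = k then 2 * δ * selProb D i else 0) +
                2 * (if k < i then selProb D i else 0)) := by
            rw [Finset.sum_add_distrib, Finset.sum_add_distrib, ← Finset.sum_mul, sum_selProb,
              one_mul, Finset.sum_ite_eq' Finset.univ k, if_pos (Finset.mem_univ k),
              ← Finset.mul_sum, worseProb]
          rw [e]
          refine Finset.sum_le_sum fun i _ => ?_
          have hp := selProb_nonneg D i
          rcases lt_trichotomy i k with hi | hi | hi
          · rw [if_neg hi.ne, if_neg hi.ne, if_neg hi.not_gt]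
            have := hgap i k hi
            rw [B.antisymm k i]
            nlinarith
          · subst hi
            simp only [if_true, lt_irrefl, if_false]
            nlinarith
          · rw [if_neg hi.ne', if_neg hi.ne', if_pos hi]
            have := (abs_le.1 (B.abs_phi_le k i)).2
            nlinarith
        have hR : ∑ i, selProb D i * (|if i = k then (0 : ℝ) else 1| + |ε|) ≤ 2 := by
          calc ∑ i, selProb D i * (|if i = k then (0 : ℝ) else 1| + |ε|)
              ≤ ∑ i, selProb D i * 2 := Finset.sum_le_sum fun i _ => by
                refine mul_le_mul_of_nonneg_left ?_ (selProb_nonneg D i)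
                rw [abs_of_pos hε]
                split_ifs <;> simp <;> linarith
            _ = 2 := by rw [← Finset.sum_mul, sum_selProb, one_mul]
        have e4 : 2 * δ * selProb D k ≤ 2 * δ * (1 - ρ) :=
          mul_le_mul_of_nonneg_left h1 (by positivity)
        have e5 : δ * ρ = 4 * ε := by rw [hεdef]; ring
        nlinarith
      · simp [if_neg hD])
  filter_upwards [h] with x ⟨C, hC⟩
  refine ⟨C, fun T => le_trans (le_of_eq (Finset.sum_congr rfl fun t _ => ?_)) (hC T)⟩
  simp only [zero_mul, add_zero]
  by_cases hD : s (stats η G x t)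
  · rw [if_pos hD]
    refine Finset.sum_congr rfl fun i _ => ?_
    rw [if_pos hD, if_pos hD]
    split_ifs with hi
    · rw [hi, duelGain_self]; simp
    · rw [one_mul]
  · rw [if_neg hD]
    simp [hD]

/-- In the rounds where arm `k` leads by more than `√(plays k)`, gains against worse arms whose
selection probability is at most of order `1 / √(plays k)` are compensated by a drift of that
order per duel, which sums up to a small multiple of `√(plays k)`. Gains against other worse arms
are left out of the sum. -/
theorem ae_exists_lead_sum_le (B : DuelingBandit K) (η : ℝ≥0) (G : ℕ → SimpleGraph (Fin m))
    (k : Fin K) {ε : ℝ} (hε : 0 < ε) (hε1 : ε ≤ 1) :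
    ∀ᵐ x ∂runLaw B η G, ∃ C : ℝ, ∀ T, ∑ t ∈ Finset.range T,
      (if √((stats η G x t).plays k) < (stats η G x t).net k then
        ∑ i, ((if k < i ∧ ε / (2 * K) / √((stats η G x t).plays k + 1) < selProb (stats η G x t) i
          then 0 else duelGain (G t) (x t) k i) -
          ε / √((stats η G x t).plays k + 1) * duelCount (G t) (x t) k i) else 0) ≤ C := by
  obtain ⟨δ, hδ, hδ4, hgap⟩ := exists_gap B
  have hK : (0 : ℝ) < K := Nat.cast_pos.2 (Nat.pos_of_ne_zero (NeZero.ne K))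
  set bad : Stats K → Prop := fun D => √(D.plays k) < D.net k with hbad
  set r : Stats K → ℝ := fun D => ε / √(D.plays k + 1) with hr
  set big : Stats K → Fin K → Prop := fun D i =>
    k < i ∧ ε / (2 * K) / √(D.plays k + 1) < selProb D i with hbig
  have hsq : ∀ D : Stats K, 1 ≤ √(D.plays k + 1) := fun D =>
    Real.le_sqrt_of_sq_le (by linarith [D.plays_nonneg k])
  have hr0 : ∀ D, 0 < r D := fun D => div_pos hε (by linarith [hsq D])
  have hr1 : ∀ D, r D ≤ 1 := fun D => by
    rw [hr]
    exact (div_le_one (by linarith [hsq D])).2 (hε1.trans (hsq D))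
  classical
  have h := ae_bddAbove_duels B η G k
    (fun D i => if bad D then (if i = k ∨ big D i then 0 else 1) else 0)
    (fun D _ => if bad D then -r D else 0) (fun _ => 0) hδ
    (fun D i => by split_ifs <;> simp)
    (fun D i => by
      split_ifs
      · rw [abs_neg, abs_of_pos (hr0 D)]; exact hr1 D
      · simp) (by simp) (fun D => by
      by_cases hD : bad D
      · simp only [if_pos hD, add_zero, abs_zero, abs_neg, abs_of_pos (hr0 D)]
        have h1 : ∑ i, (selProb D i * (2 * (if i = k ∨ big D i then 0 else 1) * B.φ k i + -r D) +
            δ * (selProb D i * (|if i = k ∨ big D i then (0 : ℝ) else 1| + r D))) ≤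
            ∑ i, (r D / (2 * K) * (1 + δ) - selProb D i * (r D * (1 - δ))) := by
          refine Finset.sum_le_sum fun i _ => ?_
          have hp := selProb_nonneg D i
          have hrD := hr0 D
          have hx : 0 ≤ r D / (2 * K) * (1 + δ) := by positivity
          by_cases hi : i = k ∨ big D i
          · simp only [if_pos hi, abs_zero]
            nlinarith
          · simp only [if_neg hi, abs_one]
            rw [not_or] at hi
            rcases lt_or_gt_of_ne hi.1 with hik | hik
            · have := hgap i k hik
              rw [B.antisymm k i]
              nlinarith
            · have hle : selProb D i ≤ r D / (2 * K) := by
                have h3 : selProb D i ≤ ε / (2 * K) / √(D.plays k + 1) :=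
                  not_lt.1 fun h => hi.2 ⟨hik, h⟩
                rwa [div_right_comm] at h3
              have h4 := (abs_le.1 (B.abs_phi_le k i)).2
              nlinarith
        have h2 : ∑ i : Fin K, (r D / (2 * K) * (1 + δ) - selProb D i * (r D * (1 - δ))) =
            r D / 2 * (1 + δ) - r D * (1 - δ) := by
          rw [Finset.sum_sub_distrib, ← Finset.sum_mul, ← Finset.sum_mul, sum_selProb]
          simp only [Finset.sum_const, Finset.card_univ, Fintype.card_fin, nsmul_eq_mul]
          field_simp
        rw [Finset.sum_add_distrib, ← Finset.mul_sum, h2] at h1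
        have := hr0 D
        nlinarith
      · simp [if_neg hD])
  filter_upwards [h] with x ⟨C, hC⟩
  refine ⟨C, fun T => le_trans (le_of_eq (Finset.sum_congr rfl fun t _ => ?_)) (hC T)⟩
  simp only [zero_mul, add_zero]
  by_cases hD : bad (stats η G x t)
  · rw [if_pos hD]
    refine Finset.sum_congr rfl fun i _ => ?_
    rw [if_pos hD, if_pos hD]
    change (if big (stats η G x t) i then 0 else _) - r (stats η G x t) * _ = _
    by_cases hi : i = k
    · rw [if_pos (Or.inl hi), hi, duelGain_self]; simp [neg_mul, sub_eq_add_neg]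
    · by_cases hb : big (stats η G x t) i
      · rw [if_pos hb, if_pos (Or.inr hb)]; ring
      · rw [if_neg hb, if_neg (not_or.2 ⟨hi, hb⟩)]; ring
  · rw [if_neg hD]
    simp [hD]

end IndSelfSparring

/-! ### Elementary bounds for sums along monotone sequences -/

namespace IndSelfSparring

theorem exists_sum_range_le_of_eventually_nonpos {E : ℕ → ℝ} (h : ∀ᶠ t in atTop, E t ≤ 0) :
    ∃ C : ℝ, ∀ T, ∑ t ∈ Finset.range T, E t ≤ C := by
  obtain ⟨T₀, hT₀⟩ := eventually_atTop.1 h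
  refine ⟨∑ t ∈ Finset.range T₀, |E t|, fun T => ?_⟩
  calc ∑ t ∈ Finset.range T, E t
      ≤ ∑ t ∈ Finset.range T, (if t < T₀ then |E t| else 0) := by
        refine Finset.sum_le_sum fun t _ => ?_
        split_ifs with ht
        · exact le_abs_self _
        · exact hT₀ t (not_lt.1 ht)
    _ = ∑ t ∈ (Finset.range T).filter (· < T₀), |E t| := (Finset.sum_filter _ _).symm
    _ ≤ _ := Finset.sum_le_sum_of_subset_of_nonneg
        (fun t ht => Finset.mem_range.2 (Finset.mem_filter.1 ht).2) fun _ _ _ => abs_nonneg _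

theorem sum_div_sqrt_le {n : ℕ → ℝ} {b : ℝ} (hb : 0 ≤ b) (hn : Monotone n) (h0 : 0 ≤ n 0)
    (hstep : ∀ t, n (t + 1) - n t ≤ b) (T : ℕ) :
    ∑ t ∈ Finset.range T, (n (t + 1) - n t) / √(n t + 1) ≤ 2 * (1 + b) * √(n T + 1) := by
  induction T with
  | zero => simp; positivity
  | succ T ih =>
    rw [Finset.sum_range_succ]
    have hT : 0 ≤ n T := h0.trans (hn (Nat.zero_le T))
    have hd : 0 ≤ n (T + 1) - n T := sub_nonneg.2 (hn T.le_succ)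
    set s := √(n T + 1) with hs
    set s' := √(n (T + 1) + 1) with hs'
    have e1 : s ^ 2 = n T + 1 := Real.sq_sqrt (by linarith)
    have e2 : s' ^ 2 = n (T + 1) + 1 := Real.sq_sqrt (by linarith)
    have hs1 : 1 ≤ s := Real.le_sqrt_of_sq_le (by linarith)
    have hle : s ≤ s' := Real.sqrt_le_sqrt (by linarith)
    have hle' : s' ≤ (1 + b) * s := by
      refine Real.sqrt_le_iff.2 ⟨by positivity, ?_⟩
      rw [mul_pow, e1]
      have h1 := hstep T
      have h2 := mul_nonneg hb hT
      have h3 := mul_nonneg (sq_nonneg b) hT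
      nlinarith
    have key : (n (T + 1) - n T) / s ≤ 2 * (1 + b) * (s' - s) := by
      rw [div_le_iff₀ (by linarith)]
      have : n (T + 1) - n T = (s' - s) * (s' + s) := by nlinarith
      rw [this]
      have : (s' - s) * (s' + s) ≤ (s' - s) * (2 * ((1 + b) * s)) :=
        mul_le_mul_of_nonneg_left (by nlinarith) (by linarith)
      nlinarith
    nlinarith

/-- While a sequence stays below a threshold that increases, its growth is at most the threshold
plus one step. -/
theorem sum_growth_below_le {n w : ℕ → ℝ} {b : ℝ} (hb : 0 ≤ b) (hn : Monotone n) (h0 : 0 ≤ n 0)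
    (hw : Monotone w) (hw0 : 0 ≤ w 0) (hstep : ∀ t, n (t + 1) - n t ≤ b) (T : ℕ) :
    ∑ t ∈ Finset.range T, (if n t < w t then n (t + 1) - n t else 0) ≤ w T + b := by
  have hle : ∀ T, ∑ t ∈ Finset.range T, (if n t < w t then n (t + 1) - n t else 0) ≤ n T := by
    intro T
    calc ∑ t ∈ Finset.range T, (if n t < w t then n (t + 1) - n t else 0)
        ≤ ∑ t ∈ Finset.range T, (n (t + 1) - n t) := Finset.sum_le_sum fun t _ => by
          have := hn t.le_succ
          simp only [Nat.succ_eq_add_one] at this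
          split_ifs <;> linarith
      _ = n T - n 0 := Finset.sum_range_sub n T
      _ ≤ n T := by linarith
  induction T with
  | zero => simp; positivity
  | succ T ih =>
    rw [Finset.sum_range_succ]
    have hmono := hw T.le_succ
    simp only [Nat.succ_eq_add_one] at hmono
    split_ifs with h
    · have h1 := hle T
      have h2 := hstep T
      linarith
    · linarith

/-! ### Elimination of the suboptimal arms along a typical run -/

variable {K m : ℕ}

/-- Arm `k` is eventually eliminated along the sequence of statistics `D`: its surplus decreases
linearly in the number of its duels, that is, its empirical mean is eventually below `1 / 2` by a
margin, unless it is dueled only finitely often. -/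
def Eliminated (D : ℕ → Stats K) (k : Fin K) : Prop :=
  ∃ κ : ℝ, 0 < κ ∧ κ ≤ 1 ∧ ∃ C : ℝ, ∀ T, (D T).net k ≤ C - κ * (D T).plays k

theorem eliminated_of_bddAbove {D : ℕ → Stats K} {k : Fin K}
    (h : BddAbove (Set.range fun T => (D T).plays k)) : Eliminated D k := by
  obtain ⟨A, hA⟩ := h
  refine ⟨1, one_pos, le_rfl, 2 * A, fun T => ?_⟩
  have h1 : (D T).plays k ≤ A := hA ⟨T, rfl⟩
  have h2 := (abs_le.1 ((D T).abs_net_le k)).2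
  linarith

variable [NeZero K]

theorem tendsto_selProb_of_bddAbove {D : ℕ → Stats K} {k : Fin K} {c : ℝ} (hc : 0 ≤ c)
    (h : BddAbove (Set.range fun T => (D T).plays k))
    (hsel : ∃ C : ℝ, ∀ T, ∑ t ∈ Finset.range T, selProb (D t) k ≤ C + c * (D T).plays k) :
    Tendsto (fun t => selProb (D t) k) atTop (𝓝 0) := by
  obtain ⟨A, hA⟩ := h
  obtain ⟨C, hC⟩ := hsel
  refine (summable_of_sum_range_le (c := C + c * A) (fun t => selProb_nonneg _ _) fun T =>
    (hC T).trans ?_).tendsto_atTop_zero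
  have := mul_le_mul_of_nonneg_left (hA ⟨T, rfl⟩ : (D T).plays k ≤ A) hc
  linarith

/-- An eliminated arm `j` is selected with vanishing probability. If it is played infinitely
often, its sample is below some `u < 1 / 2` with high probability. The maximal sample is not:
either arm `0` is played infinitely often, and its own sample exceeds `u`, or it is selected with
vanishing probability, which means that the samples of the other arms usually exceed `u`. -/
theorem Eliminated.tendsto_selProb {D : ℕ → Stats K} {j : Fin K} {c : ℝ} (hc : 0 ≤ c)
    (hmono : ∀ i, Monotone fun T => (D T).plays i)
    (hsel : ∀ i, ∃ C : ℝ, ∀ T, ∑ t ∈ Finset.range T, selProb (D t) i ≤ C + c * (D T).plays i)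
    (hnet : ∃ C : ℝ, ∀ T, -C ≤ (D T).net 0) (hj : Eliminated D j) :
    Tendsto (fun t => selProb (D t) j) atTop (𝓝 0) := by
  by_cases hb : BddAbove (Set.range fun T => (D T).plays j)
  · exact tendsto_selProb_of_bddAbove hc hb (hsel j)
  obtain ⟨κ, hκ, hκ1, C, hC⟩ := hj
  obtain ⟨C₀', hC₀'⟩ := hnet
  set C₀ := max C₀' 0 with hC₀def
  have hC₀ : ∀ T, -C₀ ≤ (D T).net 0 := fun T =>
    (neg_le_neg (le_max_left _ _)).trans (hC₀' T)
  have hC₀0 : 0 ≤ C₀ := le_max_right _ _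
  have hinf := tendsto_atTop_atTop_of_monotone' (hmono j) hb
  set u := 1 / 2 - κ / 8 with hu
  have of_weighted : ∀ {i : Fin K} {t : ℕ} {y ε : ℝ}, 0 ≤ y → ((D t).plays i + 2) * y ≤ ε →
      y ≤ ε := by
    intro i t y ε hy h
    have := (D t).plays_nonneg i
    nlinarith
  have hup : Tendsto (fun t => (posterior (D t) j).real (Set.Ici u)) atTop (𝓝 0) := by
    rw [tendsto_order]
    refine ⟨fun a ha => Eventually.of_forall fun t => ha.trans_le measureReal_nonneg,
      fun ε hε => ?_⟩
    obtain ⟨N, hN⟩ := exists_posterior_Ici_le (K := K) (C := C) hκ hκ1 (half_pos hε)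
    filter_upwards [hinf.eventually_ge_atTop N] with t ht
    exact (of_weighted measureReal_nonneg (hN (D t) j ht (hC t))).trans_lt (half_lt_self hε)
  -- If arm `0` is played finitely often, it is selected with vanishing probability as well.
  by_cases hb0 : BddAbove (Set.range fun T => (D T).plays 0)
  · have h0 := tendsto_selProb_of_bddAbove hc hb0 (hsel 0)
    set c₁ := 1 / (1 + (4 : ℝ) ^ C₀ + 3 ^ C₀) with hc₁
    have hc₁0 : 0 < c₁ := by positivity
    have hlim : Tendsto (fun t => (posterior (D t) j).real (Set.Ici u) + selProb (D t) 0 / c₁)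
        atTop (𝓝 0) := by
      simpa using hup.add (h0.div_const c₁)
    refine squeeze_zero (fun t => selProb_nonneg _ _) (fun t => ?_) hlim
    have h1 := mul_selProb_sub_le (D t) 0 j u
    have h2 : c₁ ≤ (posterior (D t) 0).real (Set.Ioi u) :=
      (le_posterior_Ioi_half hC₀0 (D t) 0 (hC₀ t)).trans
        (measureReal_mono (Set.Ioi_subset_Ioi (by linarith)))
    rcases le_total (selProb (D t) j) ((posterior (D t) j).real (Set.Ici u)) with h3 | h3
    · have : 0 ≤ selProb (D t) 0 / c₁ := div_nonneg (selProb_nonneg _ _) hc₁0.le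
      linarith
    · rw [← sub_le_iff_le_add', le_div_iff₀ hc₁0, mul_comm]
      exact (mul_le_mul_of_nonneg_right h2 (sub_nonneg.2 h3)).trans h1
  · have hinf0 := tendsto_atTop_atTop_of_monotone' (hmono 0) hb0
    have hlow : Tendsto (fun t => (posterior (D t) 0).real (Set.Iic u)) atTop (𝓝 0) := by
      rw [tendsto_order]
      refine ⟨fun a ha => Eventually.of_forall fun t => ha.trans_le measureReal_nonneg,
        fun ε hε => ?_⟩
      obtain ⟨N, hN⟩ := exists_posterior_Iic_le (K := K) (u := u) (v := 1 / 2 - κ / 16)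
        (C := C₀) (by linarith) (by linarith) (half_pos hε)
      filter_upwards [hinf0.eventually_ge_atTop N] with t ht
      exact (of_weighted measureReal_nonneg (hN (D t) 0 ht (hC₀ t))).trans_lt (half_lt_self hε)
    refine squeeze_zero (fun t => selProb_nonneg _ _) (fun t => selProb_le_add (D t) 0 j u) ?_
    simpa using hup.add hlow

/-- The coefficient of the drift allowed in the rounds where an arm leads. The step of `plays` is
at most `η * (m * m)`, so by `sum_div_sqrt_le` this drift sums up to at most `√(plays k + 1) / 4`.
-/
noncomputable def leadRate (η : ℝ≥0) (m : ℕ) : ℝ := 1 / (8 * (1 + η * (m * m)))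

/-- The properties of almost every run that the elimination argument uses: the conclusions of
`ae_exists_le_net_zero`, `ae_exists_sum_selProb_le`, `exists_ae_exists_calm_sum_le` with
`ρ = 1 / (N + 1)`, and `ae_exists_lead_sum_le` with `ε = leadRate η m`. -/
structure TypicalRun (η : ℝ≥0) (G : ℕ → SimpleGraph (Fin m)) (x : ℕ → Round K m) : Prop where
  net_zero : ∃ C : ℝ, ∀ T, -C ≤ (stats η G x T).net 0
  sum_selProb_le : ∀ k, ∃ C : ℝ, ∀ T, ∑ t ∈ Finset.range T, selProb (stats η G x t) k ≤
    C + 2 / η * (stats η G x T).plays k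
  calm : ∀ k, ∀ N : ℕ, ∃ ε : ℝ, 0 < ε ∧ ε ≤ 1 ∧ ∃ C : ℝ, ∀ T, ∑ t ∈ Finset.range T,
    (if (stats η G x t).net k ≤ √((stats η G x t).plays k) ∧
        selProb (stats η G x t) k ≤ 1 - 1 / ((N : ℝ) + 1) ∧ worseProb (stats η G x t) k ≤ ε then
      ∑ i, (duelGain (G t) (x t) k i + ε * duelCount (G t) (x t) k i) else 0) ≤ C
  lead : ∀ k, ∃ C : ℝ, ∀ T, ∑ t ∈ Finset.range T,
    (if √((stats η G x t).plays k) < (stats η G x t).net k then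
      ∑ i, ((if k < i ∧ leadRate η m / (2 * K) / √((stats η G x t).plays k + 1) <
            selProb (stats η G x t) i
        then 0 else duelGain (G t) (x t) k i) -
        leadRate η m / √((stats η G x t).plays k + 1) * duelCount (G t) (x t) k i) else 0) ≤ C

theorem leadRate_pos (η : ℝ≥0) (m : ℕ) : 0 < leadRate η m := by
  unfold leadRate; positivity

theorem leadRate_le_one (η : ℝ≥0) (m : ℕ) : leadRate η m ≤ 1 := by
  unfold leadRate
  have : 0 ≤ (η : ℝ) * (m * m) := by positivity
  rw [div_le_one (by positivity)]
  linarith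

theorem ae_typicalRun (B : DuelingBandit K) {η : ℝ≥0} (hη : 0 < η)
    (G : ℕ → SimpleGraph (Fin m)) (hG : ∀ t, G t ≠ ⊥) :
    ∀ᵐ x ∂runLaw B η G, TypicalRun η G x := by
  have hcalm := fun (k : Fin K) (N : ℕ) => exists_ae_exists_calm_sum_le B η G k
    (ρ := 1 / ((N : ℝ) + 1)) (by positivity) (by
      rw [div_le_one (by positivity)]
      have : (0 : ℝ) ≤ N := Nat.cast_nonneg N
      linarith)
  choose ε hε hε1 hcalm using hcalm
  filter_upwards [ae_exists_le_net_zero B η G,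
    ae_all_iff.2 fun k => ae_exists_sum_selProb_le B hη G hG k,
    ae_all_iff.2 fun k => ae_all_iff.2 fun N => hcalm k N,
    ae_all_iff.2 fun k => ae_exists_lead_sum_le B η G k (leadRate_pos η m) (leadRate_le_one η m)]
    with x h1 h2 h3 h4
  exact ⟨h1, h2, fun k N => ⟨ε k N, hε k N, hε1 k N, h3 k N⟩, h4⟩

/-- Suppose that all arms worse than `k` are eliminated, that `k` is played infinitely often, and
that late rounds in which `k` does not lead by more than `√(plays k)` are of the kind treated in
`exists_ae_exists_calm_sum_le`. Then along a typical run `k` leads by more than `√(plays k)` only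
finitely often. -/
theorem TypicalRun.eventually_net_le {η : ℝ≥0} {G : ℕ → SimpleGraph (Fin m)}
    {x : ℕ → Round K m} (hx : TypicalRun η G x) {k : Fin K}
    (helim : ∀ j, k < j → Eliminated (stats η G x) j)
    (hinf : Tendsto (fun T => (stats η G x T).plays k) atTop atTop)
    {N : ℕ} (hcalm : ∀ ε > 0, ∀ᶠ t in atTop,
      (stats η G x t).net k ≤ √((stats η G x t).plays k) →
        selProb (stats η G x t) k ≤ 1 - 1 / ((N : ℝ) + 1) ∧ worseProb (stats η G x t) k ≤ ε) :
    ∀ᶠ t in atTop, (stats η G x t).net k ≤ √((stats η G x t).plays k) := by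
  classical
  set D := stats η G x with hD
  have hK : (0 : ℝ) < K := Nat.cast_pos.2 (Nat.pos_of_ne_zero (NeZero.ne K))
  obtain ⟨ε, hε, hε1, C₁, hC₁⟩ := hx.calm k N
  obtain ⟨C₂, hC₂⟩ := hx.lead k
  have hη0 : (0 : ℝ) ≤ η := η.coe_nonneg
  set b : ℝ := η * (m * m) with hb
  have hb0 : 0 ≤ b := by positivity
  have hmono : ∀ i, Monotone fun T => (D T).plays i := monotone_plays η G x
  have hcount : ∀ i t, (D (t + 1)).plays i - (D t).plays i =
      η * ∑ l, duelCount (G t) (x t) i l := fun i t => by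
    rw [hD, plays_stats_succ]; ring
  have hstep : ∀ i t, (D (t + 1)).plays i - (D t).plays i ≤ b := fun i t => by
    rw [hcount]
    exact mul_le_mul_of_nonneg_left ((sum_duelCount_le _ _ _).trans (dartCount_le _)) hη0
  set s : ℕ → ℝ := fun t => √((D t).plays k + 1) with hs
  -- With the factor `1 / (4 * K)`, the gains against all rarely played arms add up to at most
  -- `√(plays k) / 4`; the drift in the leading rounds contributes another `√(plays k + 1) / 4`.
  set w : ℕ → ℝ := fun t => 1 / (4 * K) * √((D t).plays k) with hw
  have hrare : ∀ j, k < j → ∀ᶠ t in atTop, √((D t).plays k) < (D t).net k →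
      leadRate η m / (2 * K) / s t < selProb (D t) j → (D t).plays j < w t := by
    intro j hj
    obtain ⟨κ, hκ, hκ1, C, hC⟩ := helim j hj
    obtain ⟨M, hM⟩ := exists_selProb_le_div_sqrt (K := K) (C := C) hκ hκ1
      (show 0 < leadRate η m / (2 * K) from div_pos (leadRate_pos η m) (by positivity))
      (show (0 : ℝ) < 1 / (4 * K) by positivity)
    filter_upwards [hinf.eventually_ge_atTop M] with t ht h1 h2
    by_contra h3
    exact absurd (hM (D t) j k (hC t) ((Real.sqrt_nonneg _).trans h1.le) ht (not_lt.1 h3))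
      (not_le.2 h2)
  set calm : ℕ → Prop := fun t => (D t).net k ≤ √((D t).plays k) ∧
    selProb (D t) k ≤ 1 - 1 / ((N : ℝ) + 1) ∧ worseProb (D t) k ≤ ε with hcalmdef
  set big : ℕ → Fin K → Prop := fun t i =>
    k < i ∧ leadRate η m / (2 * K) / s t < selProb (D t) i with hbig
  set A₁ : ℕ → ℝ := fun t => if calm t then
      ∑ i, (duelGain (G t) (x t) k i + ε * duelCount (G t) (x t) k i) else 0 with hA₁
  set A₂ : ℕ → ℝ := fun t => if √((D t).plays k) < (D t).net k then
      ∑ i, ((if big t i then 0 else duelGain (G t) (x t) k i) -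
        leadRate η m / s t * duelCount (G t) (x t) k i) else 0 with hA₂
  set A₃ : ℕ → ℝ := fun t => ((D (t + 1)).plays k - (D t).plays k) / s t with hA₃
  set A₄ : ℕ → ℝ := fun t => ∑ j, if (D t).plays j < w t then
      (D (t + 1)).plays j - (D t).plays j else 0 with hA₄
  have hinc : ∀ j t, 0 ≤ (D (t + 1)).plays j - (D t).plays j := fun j t =>
    sub_nonneg.2 (hmono j t.le_succ)
  have hspos : ∀ t, 0 < s t := fun t => Real.sqrt_pos.2 (by linarith [(D t).plays_nonneg k])
  have hA₃0 : ∀ t, 0 ≤ A₃ t := fun t => div_nonneg (hinc k t) (hspos t).le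
  have hA₄0 : ∀ t, 0 ≤ A₄ t := fun t => Finset.sum_nonneg fun j _ => by
    split_ifs
    · exact hinc j t
    · exact le_rfl
  -- In each late round the increment of the surplus is bounded by one of the controlled sums.
  have hmain : ∀ᶠ t in atTop, η * ∑ i, duelGain (G t) (x t) k i -
      (η * A₁ t + η * A₂ t + leadRate η m * A₃ t + A₄ t) ≤ 0 := by
    have hrare' : ∀ᶠ t in atTop, ∀ j, k < j → √((D t).plays k) < (D t).net k →
        leadRate η m / (2 * K) / s t < selProb (D t) j → (D t).plays j < w t := by
      refine eventually_all.2 fun j => ?_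
      by_cases hj : k < j
      · filter_upwards [hrare j hj] with t ht _ using ht
      · exact Eventually.of_forall fun t h => absurd h hj
    filter_upwards [hcalm ε hε, hrare'] with t h1 h2
    have hl := leadRate_pos η m
    have h3 := mul_nonneg hl.le (hA₃0 t)
    have h4 := hA₄0 t
    rcases le_or_gt ((D t).net k) (√((D t).plays k)) with hle | hgt
    · have hc : calm t := ⟨hle, h1 hle⟩
      have e1 : A₁ t = ∑ i, duelGain (G t) (x t) k i + ε * ∑ i, duelCount (G t) (x t) k i := by
        rw [hA₁]; simp only [if_pos hc]
        rw [Finset.sum_add_distrib, Finset.mul_sum]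
      have e2 : A₂ t = 0 := by rw [hA₂]; simp only [if_neg hle.not_gt]
      have e3 : 0 ≤ ε * ∑ i, duelCount (G t) (x t) k i :=
        mul_nonneg hε.le (Finset.sum_nonneg fun i _ => duelCount_nonneg _ _ _ _)
      rw [e2, e1]
      nlinarith
    · have hc : ¬calm t := fun h => absurd h.1 hgt.not_ge
      have e1 : A₁ t = 0 := by rw [hA₁]; simp only [if_neg hc]
      have e2 : A₂ t = ∑ i, (if big t i then 0 else duelGain (G t) (x t) k i) -
          leadRate η m / s t * ∑ i, duelCount (G t) (x t) k i := by
        rw [hA₂]; simp only [if_pos hgt]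
        rw [Finset.sum_sub_distrib, Finset.mul_sum]
      have e3 : leadRate η m * A₃ t =
          η * (leadRate η m / s t * ∑ i, duelCount (G t) (x t) k i) := by
        rw [hA₃]; simp only [hcount]
        ring
      have e4 : η * (∑ i, duelGain (G t) (x t) k i -
          ∑ i, (if big t i then 0 else duelGain (G t) (x t) k i)) ≤ A₄ t := by
        rw [← Finset.sum_sub_distrib, Finset.mul_sum]
        refine Finset.sum_le_sum fun i _ => ?_
        by_cases hbi : big t i
        · rw [if_pos hbi, sub_zero, if_pos (h2 i hbi.1 hgt hbi.2), hcount]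
          refine mul_le_mul_of_nonneg_left ?_ hη0
          calc duelGain (G t) (x t) k i ≤ duelCount (G t) (x t) k i :=
                (le_abs_self _).trans (abs_duelGain_le _ _ _ _)
            _ = duelCount (G t) (x t) i k := duelCount_comm _ _ _ _
            _ ≤ _ := Finset.single_le_sum (fun l _ => duelCount_nonneg (G t) (x t) i l)
                (Finset.mem_univ k)
        · rw [if_neg hbi, sub_self, mul_zero]
          split_ifs
          · exact hinc i t
          · exact le_rfl
      rw [e1, e2, e3]
      linarith
  obtain ⟨C, hC⟩ := exists_sum_range_le_of_eventually_nonpos hmain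
  have hbound : ∀ T, (D T).net k ≤ (C + η * C₁ + η * C₂ + K * b) + 1 / 2 * s T := by
    intro T
    have h0 := hC T
    rw [Finset.sum_sub_distrib, Finset.sum_add_distrib, Finset.sum_add_distrib,
      Finset.sum_add_distrib, ← Finset.mul_sum, ← Finset.mul_sum, ← Finset.mul_sum,
      ← Finset.mul_sum, ← net_stats] at h0
    have h1 : η * ∑ t ∈ Finset.range T, A₁ t ≤ η * C₁ := mul_le_mul_of_nonneg_left (hC₁ T) hη0
    have h2 : η * ∑ t ∈ Finset.range T, A₂ t ≤ η * C₂ := mul_le_mul_of_nonneg_left (hC₂ T) hη0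
    have h3 : leadRate η m * ∑ t ∈ Finset.range T, A₃ t ≤ 1 / 4 * s T := by
      have := sum_div_sqrt_le hb0 (hmono k) ((D 0).plays_nonneg k) (hstep k) T
      calc leadRate η m * ∑ t ∈ Finset.range T, A₃ t
          ≤ leadRate η m * (2 * (1 + b) * s T) :=
            mul_le_mul_of_nonneg_left this (leadRate_pos η m).le
        _ = 1 / 4 * s T := by
            rw [leadRate, ← hb]
            have : 1 + b ≠ 0 := by positivity
            field_simp
            ring
    have h4 : ∑ t ∈ Finset.range T, A₄ t ≤ 1 / 4 * s T + K * b := by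
      rw [hA₄, Finset.sum_comm]
      have hwm : Monotone w := fun t t' htt' =>
        mul_le_mul_of_nonneg_left (Real.sqrt_le_sqrt (hmono k htt')) (by positivity)
      have hws : w T ≤ 1 / (4 * K) * s T :=
        mul_le_mul_of_nonneg_left (Real.sqrt_le_sqrt (by linarith)) (by positivity)
      calc ∑ j, ∑ t ∈ Finset.range T, (if (D t).plays j < w t then
            (D (t + 1)).plays j - (D t).plays j else 0)
          ≤ ∑ _j : Fin K, (1 / (4 * K) * s T + b) := Finset.sum_le_sum fun j _ =>
            (sum_growth_below_le hb0 (hmono j) ((D 0).plays_nonneg j) hwm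
              (by positivity) (hstep j) T).trans (by linarith)
        _ = _ := by
            simp only [Finset.sum_const, Finset.card_univ, Fintype.card_fin, nsmul_eq_mul]
            field_simp
    linarith
  set c := C + η * C₁ + η * C₂ + K * b with hc
  filter_upwards [hinf.eventually_ge_atTop (max 1 ((8 * c) ^ 2))] with t ht
  have hn1 : 1 ≤ (D t).plays k := (le_max_left _ _).trans ht
  have hn2 : 8 * c ≤ √((D t).plays k) := by
    refine (le_abs_self _).trans ?_
    rw [← Real.sqrt_sq_eq_abs]
    exact Real.sqrt_le_sqrt ((le_max_right _ _).trans ht)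
  have hs1 : s t ≤ 3 / 2 * √((D t).plays k) := by
    rw [hs, Real.sqrt_le_left (by positivity), mul_pow, Real.sq_sqrt (by linarith)]
    linarith
  have := hbound t
  have := Real.sqrt_nonneg ((D t).plays k)
  linarith

/-- Along a typical run, a suboptimal arm is eliminated once all worse arms are. -/
theorem TypicalRun.eliminated_of_worse {η : ℝ≥0} {G : ℕ → SimpleGraph (Fin m)}
    {x : ℕ → Round K m} (hx : TypicalRun η G x) {k : Fin K} (hk : k ≠ 0)
    (helim : ∀ j, k < j → Eliminated (stats η G x) j) : Eliminated (stats η G x) k := by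
  by_cases hbdd : BddAbove (Set.range fun T => (stats η G x T).plays k)
  · exact eliminated_of_bddAbove hbdd
  have hinf := tendsto_atTop_atTop_of_monotone' (monotone_plays η G x k) hbdd
  have hη0 : (0 : ℝ) ≤ η := η.coe_nonneg
  have hworse : Tendsto (fun t => worseProb (stats η G x t) k) atTop (𝓝 0) := by
    rw [← Finset.sum_const_zero (s := (Finset.univ : Finset (Fin K)))]
    refine tendsto_finsetSum _ fun j _ => ?_
    split_ifs with hj
    · exact (helim j hj).tendsto_selProb (by positivity) (monotone_plays η G x)
        hx.sum_selProb_le hx.net_zero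
    · exact tendsto_const_nhds
  obtain ⟨C₀, hC₀⟩ := hx.net_zero
  obtain ⟨ρ, hρ, hsel⟩ := exists_selProb_le_one_sub (K := K) (le_max_right C₀ 0)
  obtain ⟨N, hN⟩ := exists_nat_one_div_lt hρ
  have hcalm : ∀ ε > 0, ∀ᶠ t in atTop,
      (stats η G x t).net k ≤ √((stats η G x t).plays k) →
        selProb (stats η G x t) k ≤ 1 - 1 / ((N : ℝ) + 1) ∧
          worseProb (stats η G x t) k ≤ ε := by
    intro ε hε
    filter_upwards [hworse.eventually_le_const hε, hinf.eventually_ge_atTop 14] with t h1 h2 h3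
    refine ⟨?_, h1⟩
    have := hsel _ 0 k hk.symm ((neg_le_neg (le_max_left C₀ 0)).trans (hC₀ t)) h2 h3
    linarith
  have hev := hx.eventually_net_le helim hinf hcalm
  obtain ⟨ε, hε, hε1, C₁, hC₁⟩ := hx.calm k N
  set A : ℕ → ℝ := fun t => if (stats η G x t).net k ≤ √((stats η G x t).plays k) ∧
        selProb (stats η G x t) k ≤ 1 - 1 / ((N : ℝ) + 1) ∧ worseProb (stats η G x t) k ≤ ε then
      ∑ i, (duelGain (G t) (x t) k i + ε * duelCount (G t) (x t) k i) else 0 with hA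
  have hmain : ∀ᶠ t in atTop, η * ∑ i, duelGain (G t) (x t) k i +
      ε * (η * ∑ i, duelCount (G t) (x t) k i) - η * A t ≤ 0 := by
    filter_upwards [hev, hcalm ε hε] with t h1 h2
    rw [hA]
    simp only [if_pos (show _ ∧ _ from ⟨h1, h2 h1⟩)]
    rw [Finset.sum_add_distrib, ← Finset.mul_sum]
    exact le_of_eq (by ring)
  obtain ⟨C, hC⟩ := exists_sum_range_le_of_eventually_nonpos hmain
  refine ⟨ε, hε, hε1, C + η * C₁, fun T => ?_⟩
  have h0 := hC T
  rw [Finset.sum_sub_distrib, Finset.sum_add_distrib, ← Finset.mul_sum, ← Finset.mul_sum,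
    ← Finset.mul_sum, ← Finset.mul_sum, ← net_stats, ← plays_stats] at h0
  have h1 : η * ∑ t ∈ Finset.range T, A t ≤ η * C₁ := mul_le_mul_of_nonneg_left (hC₁ T) hη0
  linarith

theorem TypicalRun.eliminated {η : ℝ≥0} {G : ℕ → SimpleGraph (Fin m)}
    {x : ℕ → Round K m} (hx : TypicalRun η G x) (k : Fin K) (hk : k ≠ 0) :
    Eliminated (stats η G x) k := by
  induction k using WellFoundedGT.induction with
  | ind k ih =>
    exact hx.eliminated_of_worse hk fun j hj =>
      ih j hj (Fin.pos_iff_ne_zero.1 ((Fin.zero_le k).trans_lt hj))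

theorem TypicalRun.tendsto_selProb_zero {η : ℝ≥0} {G : ℕ → SimpleGraph (Fin m)}
    {x : ℕ → Round K m} (hx : TypicalRun η G x) :
    Tendsto (fun t => selProb (stats η G x t) 0) atTop (𝓝 1) := by
  have h : ∀ t, selProb (stats η G x t) 0 =
      1 - ∑ j ∈ Finset.univ.erase 0, selProb (stats η G x t) j := fun t => by
    rw [← sum_selProb (stats η G x t), ← Finset.add_sum_erase _ _ (Finset.mem_univ 0)]
    ring
  simp_rw [h]
  have h0 : Tendsto (fun t => ∑ j ∈ Finset.univ.erase 0, selProb (stats η G x t) j) atTop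
      (𝓝 (∑ j ∈ (Finset.univ : Finset (Fin K)).erase 0, 0)) :=
    tendsto_finsetSum _ fun j hj =>
      (hx.eliminated j (Finset.ne_of_mem_erase hj)).tendsto_selProb (by positivity)
        (monotone_plays η G x) hx.sum_selProb_le hx.net_zero
  simpa using h0.const_sub 1

/-! ### Convergence -/

/-- The slots are filled independently with the law `selectLaw` of the current statistics. -/
theorem runLaw_real_select (B : DuelingBandit K) (η : ℝ≥0) (G : ℕ → SimpleGraph (Fin m))
    (j : Fin m) (i : Fin K) (n : ℕ) :
    (runLaw B η G).real {x | (x (n + 1)).1 j = i} =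
      ∫ x, selProb (stats η G x (n + 1)) i ∂runLaw B η G := by
  have hmeas : MeasurableSet {x : ℕ → Round K m | (x (n + 1)).1 j = i} :=
    (show Measurable fun x : ℕ → Round K m => (x (n + 1)).1 j by fun_prop)
      (measurableSet_singleton i)
  have h1 : (runLaw B η G).real {x | (x (n + 1)).1 j = i} =
      ∫ x, (if (x (n + 1)).1 j = i then (1 : ℝ) else 0) ∂runLaw B η G := by
    rw [← integral_indicator_one hmeas]
    refine integral_congr_ae (Eventually.of_forall fun x => ?_)
    simp [Set.indicator]
  rw [h1, integral_history_next B η G n (fun _ y => if y.1 j = i then (1 : ℝ) else 0)]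
  refine integral_congr_ae (Eventually.of_forall fun x => ?_)
  simp only
  rw [integral_roundLaw]
  have h2 := measurePreserving_eval
    (fun _ : Fin m => selectLaw (stats η G x (n + 1))) j
  have h3 := integral_map (μ := Measure.pi fun _ : Fin m => selectLaw (stats η G x (n + 1)))
    (f := fun a : Fin K => if a = i then (1 : ℝ) else 0) h2.measurable.aemeasurable
    (measurable_of_countable _).aestronglyMeasurable
  rw [h2.map_eq] at h3
  rw [selProb, ← integral_indicator_one (measurableSet_singleton i)]
  trans ∫ s, (if Function.eval j s = i then (1 : ℝ) else 0)
    ∂(Measure.pi fun _ : Fin m => selectLaw (stats η G x (n + 1)))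
  · refine integral_congr_ae (Eventually.of_forall fun s => ?_)
    by_cases hs : s j = i <;> simp [hs]
  · refine h3.symm.trans (integral_congr_ae (Eventually.of_forall fun a => ?_))
    simp [Set.indicator]

end IndSelfSparring

theorem theorem1 {K m : ℕ} [NeZero K] (B : DuelingBandit K) (hB : B.ApproxLinear)
    (η : ℝ≥0) (hη : 0 < η)
    (G : ℕ → SimpleGraph (Fin m)) (hG : ∀ t, G t ≠ ⊥) (j : Fin m) :
    Tendsto (fun t : ℕ => (IndSelfSparring.runLaw B η G).real {x | (x t).1 j = 0})
      atTop (𝓝 1) := by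
  -- The selection probabilities describe the rounds after the initial one.
  rw [← tendsto_add_atTop_iff_nat 1]
  simp_rw [IndSelfSparring.runLaw_real_select]
  have h1 : (1 : ℝ) = ∫ _, (1 : ℝ) ∂IndSelfSparring.runLaw B η G := by simp
  rw [h1]
  refine tendsto_integral_of_dominated_convergence (fun _ => 1) (fun n => ?_)
    (integrable_const 1) (fun n => Eventually.of_forall fun x => ?_) ?_
  · exact (IndSelfSparring.measurable_of_history' n _ fun x y h => by
      rw [IndSelfSparring.stats_congr η G (n + 1)
        fun t ht => h t (Nat.lt_succ_iff.1 ht)]).aestronglyMeasurable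
  · rw [Real.norm_eq_abs, abs_of_nonneg (IndSelfSparring.selProb_nonneg _ _)]
    exact IndSelfSparring.selProb_le_one _ _
  · filter_upwards [IndSelfSparring.ae_typicalRun B hη G hG] with x hx
    exact hx.tendsto_selProb_zero.comp (tendsto_add_atTop_nat 1)
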